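/- Fix a set $\mathsf{Act}$ of actions and an infinite set $\mathsf{Var}$ of variables. A model $\mathcal M$ is a set $M$ of points with a relation ${\stackrel{\tau}{\to}}\subseteq M\times M$ for every $\tau\in\mathsf{Act}$; a valuation is a map $\mathsf{val}:\mathsf{Var}\to\mathcal P(M)$. **Formulas.** For a monotone map $F$ on a complete lattice and an ordinal $\alpha$ let $F^\alpha_\mu=\bigvee_{\beta<\alpha}F(F^\beta_\mu)$ and $F^\alpha_\nu=\bigwedge_{\beta<\alpha}F(F^\beta_\nu)$, and let $F^\infty_\mu,F^\infty_\nu$ be the least and the greatest fixpoint of $F$. Formulas of the (vectorial) countdown $\mu$-calculus are $$\phi::=x\mid\top\mid\bot\mid\phi_1\vee\phi_2\mid\phi_1\wedge\phi_2\mid\langle\tau\rangle\phi\mid[\tau]\phi\mid\mu^\alpha_i\overline x.\overline\phi\mid\nu^\alpha_i\overline x.\overline\phi,$$ where $x\in\mathsf{Var}$, $\tau\in\mathsf{Act}$, $\alpha$ is an ordinal or $\infty$, $\overline x=\langle x_1,\dots,x_n\rangle$ is a tuple of pairwise distinct variables, $\overline\phi=\langle\phi_1,\dots,\phi_n\rangle$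 is a tuple of formulas and $1\le i\le n<\omega$. The meaning $[\![\phi]\!]^{\mathsf{val}}\subseteq M$ is defined by induction: variables are interpreted by $\mathsf{val}$, the connectives $\top,\bot,\vee,\wedge$ as usual, $\mathsf m\in[\![\langle\tau\rangle\phi]\!]^{\mathsf{val}}$ (resp. $\mathsf m\in[\![[\tau]\phi]\!]^{\mathsf{val}}$) iff $\mathsf n\in[\![\phi]\!]^{\mathsf{val}}$ for some (resp. every) $\mathsf n$ with $\mathsf m\stackrel{\tau}{\to}\mathsf n$, and for $\eta\in\{\mu,\nu\}$, $[\![\eta^\alpha_i\overline x.\overline\phi]\!]^{\mathsf{val}}$ is the $i$-th component of $F^\alpha_\eta$ for the map $F(H_1,\dots,H_n)=([\![\phi_j]\!]^{\mathsf{val}[x_1\mapsto H_1,\dots,x_n\mapsto H_n]})_{j\le n}$ on $\mathcal P(M)^n$. **Games.** A countdown game has a set of positions divided between the players $\exists$ and $\forall$, an edge relation $E$ on positions, a map $\mathsf{rank}$ from positions to a finite linear order $\mathcal R$ that is divided between the players, a set $\mathcal D\subseteq\mathcal R$ of nonstandard ranks, and an initial counter valuation $\mathsf{ctr}_I:\mathcal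 D\to\mathsf{Ord}$. Configurations are positional, $\langle v,\mathsf{ctr}\rangle$, or countdown, $[v,\mathsf{ctr}]$, with $\mathsf{ctr}:\mathcal D\to\mathsf{Ord}$. From $\langle v,\mathsf{ctr}\rangle$ the owner of $v$ chooses $(v,w)\in E$ and the game moves to $[w,\mathsf{ctr}]$. From $[v,\mathsf{ctr}]$ the owner of $r=\mathsf{rank}(v)$ chooses $\mathsf{ctr}'$ with $\mathsf{ctr}'(r')=\mathsf{ctr}_I(r')$ for $r'<r$, $\mathsf{ctr}'(r)<\mathsf{ctr}(r)$ if $r\in\mathcal D$, and $\mathsf{ctr}'(r')=\mathsf{ctr}(r')$ for $r'>r$, and the game moves to $\langle v,\mathsf{ctr}'\rangle$. A player who has to move but cannot loses; an infinite play is lost by the owner of the greatest rank that appears in it infinitely often. Strategies are partial functions from finite plays to moves. **Automata.** A countdown automaton $\mathcal A$ consists of a finite set $Q$ of states divided between the players, an initial state $q_I\in Q$, a function $\delta$ that assigns to every $q\in Q$ either a finite subset of $Q\sqcup\mathsf{Var}$ or an element of $\mathsf{Act}\times(Q\sqcup\mathsf{Var})$, a map $\mathsf{rank}:Q\to\mathcal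 R$ to a finite linear order that is divided between the players, a set $\mathcal D\subseteq\mathcal R$ and initial counter values $\mathsf{ctr}_I:\mathcal D\to\mathsf{Ord}$. For a model and a valuation, its semantic game has positions $M\times(Q\sqcup\mathsf{Var})$. From $(\mathsf m,q)$ with $q\in Q$ there are edges to all $(\mathsf m,z)$ with $z\in\delta(q)$ if $\delta(q)\subseteq Q\sqcup\mathsf{Var}$, and to all $(\mathsf n,p)$ with $\mathsf m\stackrel{\tau}{\to}\mathsf n$ if $\delta(q)=(\tau,p)$; the owner and the rank of $(\mathsf m,q)$ are those of $q$. From $(\mathsf m,x)$ with $x\in\mathsf{Var}$ there are no edges; this position belongs to $\forall$ if $\mathsf m\in\mathsf{val}(x)$ and to $\exists$ otherwise, and its rank is an additional standard rank below all of $\mathcal R$. The language $[\![\mathcal A]\!]^{\mathsf{val}}\subseteq M$ is the set of all $\mathsf m$ such that $\exists$ has a winning strategy from $\langle(\mathsf m,q_I),\mathsf{ctr}_I\rangle$. **Theorem.** Countdown automata and the countdown $\mu$-calculus are equally expressive: 1. for every countdown automaton $\mathcal A$ there is a formula $\phi_{\mathcal A}$ of the countdown $\mu$-calculus such that $[\![\mathcal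 A]\!]^{\mathsf{val}}=[\![\phi_{\mathcal A}]\!]^{\mathsf{val}}$ for every model $\mathcal M$ and every valuation $\mathsf{val}$; 2. conversely, for every formula $\phi$ of the countdown $\mu$-calculus there is a countdown automaton $\mathcal A_\phi$ such that $[\![\phi]\!]^{\mathsf{val}}=[\![\mathcal A_\phi]\!]^{\mathsf{val}}$ for every model $\mathcal M$ and every valuation $\mathsf{val}$. -/

import Mathlib

universe o w

namespace Countdown

/-! ### Ordinal approximations of fixpoints -/

section Approximations

variable {L : Type*} [CompleteLattice L]

/-- The increasing approximations `F^α_μ = ⋁_{β < α} F (F^β_μ)`. -/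
noncomputable def muApprox (F : L → L) (α : Ordinal.{o}) : L :=
  ⨆ β : Set.Iio α, F (muApprox F β.1)
termination_by α
decreasing_by exact β.2

/-- The decreasing approximations `F^α_ν = ⋀_{β < α} F (F^β_ν)`. -/
noncomputable def nuApprox (F : L → L) (α : Ordinal.{o}) : L :=
  ⨅ β : Set.Iio α, F (nuApprox F β.1)
termination_by α
decreasing_by exact β.2

/-- The least fixpoint of a monotone map (see `isLeast_muInf`). -/
def muInf (F : L → L) : L := sInf {a | F a ≤ a}

/-- The greatest fixpoint of a monotone map (see `isGreatest_nuInf`). -/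
def nuInf (F : L → L) : L := sSup {a | a ≤ F a}

theorem isLeast_muInf {F : L → L} (hF : Monotone F) : IsLeast {a | F a = a} (muInf F) := by
  have h := OrderHom.isLeast_lfp (⟨F, hF⟩ : L →o L)
  exact h

theorem isGreatest_nuInf {F : L → L} (hF : Monotone F) :
    IsGreatest {a | F a = a} (nuInf F) := by
  have h := OrderHom.isGreatest_gfp (⟨F, hF⟩ : L →o L)
  exact h

end Approximations

/-- The two kinds of fixpoint operators. -/
inductive FixKind
  | mu
  | nu

/-- `F^α_η` for `η ∈ {μ, ν}` and `α` an ordinal or `∞` (here `⊤`). -/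
noncomputable def approx {L : Type*} [CompleteLattice L] (η : FixKind) (F : L → L)
    (α : WithTop Ordinal.{o}) : L :=
  match η, α with
  | .mu, ⊤ => muInf F
  | .mu, (β : Ordinal.{o}) => muApprox F β
  | .nu, ⊤ => nuInf F
  | .nu, (β : Ordinal.{o}) => nuApprox F β

/-! ### The vectorial countdown `μ`-calculus -/

/-- Formulas of the (full, vectorial) countdown `μ`-calculus over actions `Act` and variables
`Var`. The last constructor is `η^α_i (x₁, …, xₙ). (φ₁, …, φₙ)`, with pairwise distinct bound
variables `x₁, …, xₙ`; `n ≥ 1` is forced by the index `i`. -/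
inductive Formula (Act : Type*) (Var : Type*)
  | var (x : Var)
  | top
  | bot
  | or (φ ψ : Formula Act Var)
  | and (φ ψ : Formula Act Var)
  | dia (τ : Act) (φ : Formula Act Var)
  | box (τ : Act) (φ : Formula Act Var)
  | fix (η : FixKind) (α : WithTop Ordinal.{o}) {n : ℕ} (x : Fin n ↪ Var)
      (φ : Fin n → Formula Act Var) (i : Fin n)

/-- The meaning of a formula in the model with points `M` and transition relations `step`,
under the valuation `val`. `Function.extend x H val` is `val[x₁ ↦ H₁, …, xₙ ↦ Hₙ]`. -/
noncomputable def Formula.sem {Act Var M : Type*} (step : Act → M → M → Prop) :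
    Formula.{o} Act Var → (Var → Set M) → Set M
  | .var x, val => val x
  | .top, _ => Set.univ
  | .bot, _ => ∅
  | .or φ ψ, val => φ.sem step val ∪ ψ.sem step val
  | .and φ ψ, val => φ.sem step val ∩ ψ.sem step val
  | .dia τ φ, val => {m | ∃ n, step τ m n ∧ n ∈ φ.sem step val}
  | .box τ φ, val => {m | ∀ n, step τ m n → n ∈ φ.sem step val}
  | .fix η α x φ i, val =>
      approx η (fun H j => (φ j).sem step (Function.extend x H val)) α i

theorem muApprox_mono {L : Type*} [CompleteLattice L] {F G : L → L} (hF : Monotone F)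
    (h : ∀ a, F a ≤ G a) (α : Ordinal.{o}) : muApprox F α ≤ muApprox G α := by
  induction α using WellFoundedLT.induction with
  | ind α ih =>
    rw [muApprox, muApprox]
    exact iSup_mono fun β => (hF (ih β.1 β.2)).trans (h _)

theorem nuApprox_mono {L : Type*} [CompleteLattice L] {F G : L → L} (hG : Monotone G)
    (h : ∀ a, F a ≤ G a) (α : Ordinal.{o}) : nuApprox F α ≤ nuApprox G α := by
  induction α using WellFoundedLT.induction with
  | ind α ih =>
    rw [nuApprox, nuApprox]
    exact iInf_mono fun β => (h _).trans (hG (ih β.1 β.2))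

theorem approx_mono {L : Type*} [CompleteLattice L] (η : FixKind) {F G : L → L}
    (hF : Monotone F) (hG : Monotone G) (h : ∀ a, F a ≤ G a) (α : WithTop Ordinal.{o}) :
    approx η F α ≤ approx η G α := by
  cases η <;> cases α
  · exact sInf_le_sInf fun a (ha : G a ≤ a) => (h a).trans ha
  · exact muApprox_mono hF h _
  · exact sSup_le_sSup fun a (ha : a ≤ F a) => ha.trans (h a)
  · exact nuApprox_mono hG h _

theorem extend_mono {Var L : Type*} [Preorder L] {n : ℕ} (x : Fin n ↪ Var)
    {H H' : Fin n → L} {v v' : Var → L} (h : H ≤ H') (hv : v ≤ v') :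
    Function.extend x H v ≤ Function.extend x H' v' := by
  intro y
  by_cases hy : ∃ j, x j = y
  · obtain ⟨j, rfl⟩ := hy
    rw [x.injective.extend_apply, x.injective.extend_apply]
    exact h j
  · rw [Function.extend_apply' _ _ _ hy, Function.extend_apply' _ _ _ hy]
    exact hv y

/-- The semantics is monotone, so the maps to which `approx` is applied in `Formula.sem` are
monotone and `muInf`, `nuInf` are there the least and the greatest fixpoints. -/
theorem Formula.sem_mono {Act Var M : Type*} (step : Act → M → M → Prop)
    (φ : Formula.{o} Act Var) : Monotone (φ.sem step) := by
  induction φ with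
  | var x => exact fun v v' h => h x
  | top => exact fun v v' h => le_rfl
  | bot => exact fun v v' h => le_rfl
  | or φ ψ h1 h2 => exact fun v v' h => Set.union_subset_union (h1 h) (h2 h)
  | and φ ψ h1 h2 => exact fun v v' h => Set.inter_subset_inter (h1 h) (h2 h)
  | dia τ φ ih => exact fun v v' h m ⟨n, hn, hm⟩ => ⟨n, hn, ih h hm⟩
  | box τ φ ih => exact fun v v' h m hm n hn => ih h (hm n hn)
  | fix η α x φ i ih =>
    intro v v' h
    exact approx_mono η (fun H H' hH j => ih j (extend_mono x hH le_rfl))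
      (fun H H' hH j => ih j (extend_mono x hH le_rfl))
      (fun H j => ih j (extend_mono x le_rfl h)) α i

/-! ### Countdown games -/

/-- The two players. -/
inductive Player
  | eve
  | adam

/-- A countdown game with positions `V` and ranks `R`. -/
structure Game (V : Type*) (R : Type*) where
  /-- the owner of a position -/
  owner : V → Player
  /-- the edge relation -/
  edge : V → V → Prop
  /-- the rank of a position -/
  rank : V → R
  /-- the owner of a rank -/
  rankOwner : R → Player
  /-- the set of nonstandard ranks -/
  nonstd : Set R
  /-- the initial counter valuation -/
  ctrI : nonstd → Ordinal.{o}

namespace Game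

variable {V R : Type*}

/-- Configurations: a position and a counter valuation, in positional or countdown mode. -/
inductive Config (G : Game.{o} V R)
  | positional (v : V) (ctr : G.nonstd → Ordinal.{o})
  | countdown (v : V) (ctr : G.nonstd → Ordinal.{o})

variable {G : Game.{o} V R}

/-- The position of a configuration. -/
def Config.pos : G.Config → V
  | .positional v _ => v
  | .countdown v _ => v

/-- The player who moves in a configuration. -/
def Config.mover : G.Config → Player
  | .positional v _ => G.owner v
  | .countdown v _ => G.rankOwner (G.rank v)

variable (G) in
/-- `ctr'` is a legal update of `ctr` at rank `r`: lower counters are reset, the counter of `r`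
(if any) is decremented, higher counters are unchanged. -/
def CtrUpdate [LinearOrder R] (r : R) (ctr ctr' : G.nonstd → Ordinal.{o}) : Prop :=
  ∀ s : G.nonstd,
    (s.1 < r → ctr' s = G.ctrI s) ∧ (s.1 = r → ctr' s < ctr s) ∧ (r < s.1 → ctr' s = ctr s)

variable (G) in
/-- The moves of the game. -/
inductive Move [LinearOrder R] : G.Config → G.Config → Prop
  | edge {v v' : V} {ctr : G.nonstd → Ordinal.{o}} :
      G.edge v v' → Move (.positional v ctr) (.countdown v' ctr)
  | count {v : V} {ctr ctr' : G.nonstd → Ordinal.{o}} :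
      G.CtrUpdate (G.rank v) ctr ctr' → Move (.countdown v ctr) (.positional v ctr')

variable (G) in
/-- A strategy: a partial function from finite plays to moves (given by their targets). -/
abbrev Strategy := List G.Config → Option G.Config

/-- `IsPlay P σ γ π`: `π` is a nonempty finite play from `γ` that is consistent with the
strategy `σ` of player `P`. -/
inductive IsPlay [LinearOrder R] (P : Player) (σ : G.Strategy) (γ : G.Config) :
    List G.Config → Prop
  | start : IsPlay P σ γ [γ]
  | step {π : List G.Config} {c c' : G.Config} :
      IsPlay P σ γ (π ++ [c]) → G.Move c c' → (c.mover = P → σ (π ++ [c]) = some c') →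
      IsPlay P σ γ (π ++ [c] ++ [c'])

/-- An infinite play from `γ` consistent with the strategy `σ` of `P`. -/
def IsInfinitePlay [LinearOrder R] (P : Player) (σ : G.Strategy) (γ : G.Config)
    (f : ℕ → G.Config) : Prop :=
  ∀ n, IsPlay P σ γ ((List.range (n + 1)).map f)

/-- An infinite play is won by `P` iff the greatest rank that appears infinitely often in it is
not owned by `P`. -/
def WinsInfinite [LinearOrder R] (P : Player) (f : ℕ → G.Config) : Prop :=
  ∃ r, IsGreatest {s | ∃ᶠ n in Filter.atTop, G.rank (f n).pos = s} r ∧ G.rankOwner r ≠ P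

/-- The strategy `σ` of `P` is winning from `γ`: `P` wins every play from `γ` consistent with
`σ`. That is, `P` always has a move prescribed by `σ` when it is `P`'s turn (and so never gets
stuck), and all infinite plays are won by `P`. -/
def IsWinning [LinearOrder R] (P : Player) (σ : G.Strategy) (γ : G.Config) : Prop :=
  (∀ π c, IsPlay P σ γ (π ++ [c]) → c.mover = P → ∃ c', G.Move c c' ∧ σ (π ++ [c]) = some c') ∧
    ∀ f, IsInfinitePlay P σ γ f → WinsInfinite P f

/-- Player `P` wins from the configuration `γ`. -/
def Wins [LinearOrder R] (P : Player) (γ : G.Config) : Prop :=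
  ∃ σ : G.Strategy, IsWinning P σ γ

end Game

/-! ### Countdown automata -/

/-- A countdown automaton over actions `Act` and variables `Var`, with states `Q` and ranks `R`
(both are required to be finite where automata are used). In `delta`, the left summand holds the
`ε`-transitions and the right one the modal transitions. -/
structure Automaton (Act Var Q R : Type*) where
  /-- the owner of a state -/
  owner : Q → Player
  /-- the initial state -/
  init : Q
  /-- the transition function -/
  delta : Q → Finset (Q ⊕ Var) ⊕ (Act × (Q ⊕ Var))
  /-- the rank of a state -/
  rank : Q → R
  /-- the owner of a rank -/
  rankOwner : R → Player
  /-- the set of nonstandard ranks -/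
  nonstd : Set R
  /-- the initial counter values -/
  ctrI : nonstd → Ordinal.{o}

namespace Automaton

variable {Act Var Q R M : Type*}

/-- The edges of the semantic game. There are none from `(m, x)` with `x` a variable. -/
inductive GameEdge (A : Automaton.{o} Act Var Q R) (step : Act → M → M → Prop) :
    M × (Q ⊕ Var) → M × (Q ⊕ Var) → Prop
  | eps {m : M} {q : Q} {S : Finset (Q ⊕ Var)} {z : Q ⊕ Var} :
      A.delta q = .inl S → z ∈ S → GameEdge A step (m, .inl q) (m, z)
  | modal {m n : M} {q : Q} {τ : Act} {p : Q ⊕ Var} :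
      A.delta q = .inr (τ, p) → step τ m n → GameEdge A step (m, .inl q) (n, p)

open Classical in
/-- The semantic game. The rank of the terminal positions `(m, x)`, `x ∈ Var`, is a fresh
standard rank `⊥` below all ranks of the automaton (whose owner does not matter), so that no
counter is touched there. -/
noncomputable def game (A : Automaton.{o} Act Var Q R) (step : Act → M → M → Prop)
    (val : Var → Set M) : Game.{o} (M × (Q ⊕ Var)) (WithBot R) where
  owner
    | (_, .inl q) => A.owner q
    | (m, .inr x) => if m ∈ val x then .adam else .eve
  edge := A.GameEdge step
  rank
    | (_, .inl q) => (A.rank q : WithBot R)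
    | (_, .inr _) => ⊥
  rankOwner
    | ⊥ => .adam
    | (r : R) => A.rankOwner r
  nonstd := {r | ∃ h : r ≠ ⊥, r.unbot h ∈ A.nonstd}
  ctrI r := A.ctrI ⟨r.1.unbot r.2.fst, r.2.snd⟩

/-- The language of an automaton: the points `m` such that Eve wins the semantic game from the
positional configuration at `(m, q_I)` with the initial counter values. -/
def language [LinearOrder R] (A : Automaton.{o} Act Var Q R) (step : Act → M → M → Prop)
    (val : Var → Set M) : Set M :=
  {m | Game.Wins (G := A.game step val) .eve (.positional (m, .inl A.init) (A.game step val).ctrI)}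

end Automaton

end Countdown

/-!
The semantic game of a countdown automaton is a parity game on configurations, and its winner is
computed by a nested fixpoint `System.nested`. The unknowns are the states, the equations describe
one step of the automaton (`Automaton.stepOp`), and at each rank one takes the approximation
`F^α_η`, where `α` is the counter value (`∞` for standard ranks), `η` is determined by the owner of
the rank, and higher ranks are solved further outside. Once this is known
(`Automaton.language_eq`), the theorem becomes a matter of comparing approximations of monotone
maps.

**The game.** In a universe large enough for the model, the fixpoint `F^∞_μ` obeys the same
recursion `⋁_{β < ∞} F(F^β_μ)` as the approximations (`approx_mu_eq_iSup`). So, when a point is in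
the nested fixpoint, Eve may pretend that her standard ranks have counters as well: at each visit of
such a rank some ordinal `β < ∞` bounds the remaining visits before the next visit of a greater
rank. Her strategy is to keep the virtual counters lexicographically least, with greater ranks being
more significant. If the greatest rank `r` seen infinitely often were hers, then the counters at
ranks `≥ r` would from some point on never increase and infinitely often decrease, which is
impossible. Points outside of the nested fixpoint are won by Adam in the same way, with greatest
fixpoints in place of least ones. Both cases are instances of `Game.Certificate.wins`, and the
players cannot both win (`Game.not_wins_both`).

**From automata to formulas.** A nested fixpoint is almost literally a formula
(`Automaton.exists_formula_nested`): each rank contributes a vectorial fixpoint operator over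
variables that stand for its states. Substitution is avoided by binding the variables with one more
fixpoint operator, in a system that just assigns values to them.

**From formulas to automata.** By induction on the formula. A single construction,
`Combine.combine`, covers all cases: given automata for the immediate subformulas, a new greatest
rank is added together with states to enter these automata, and bound variables lead back to these
states. Nested fixpoints are local (`System.nested_comp`), so inside the new rank each of the
automata computes what it did on its own, and hence the new rank computes the fixpoint in question
(`Combine.language_combine`).
-/

universe u

namespace Countdown

/-! ### Approximations of fixpoints -/

section Approximations

variable {L : Type*} [CompleteLattice L]

theorem muApprox_le_muInf {F : L → L} (hF : Monotone F) (α : Ordinal.{o}) :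
    muApprox F α ≤ muInf F := by
  induction α using WellFoundedLT.induction with
  | ind α ih =>
    rw [muApprox]
    exact iSup_le fun β => (hF (ih β.1 β.2)).trans (isLeast_muInf hF).1.le

theorem nuInf_le_nuApprox {F : L → L} (hF : Monotone F) (α : Ordinal.{o}) :
    nuInf F ≤ nuApprox F α := by
  induction α using WellFoundedLT.induction with
  | ind α ih =>
    rw [nuApprox]
    exact le_iInf fun β => (isGreatest_nuInf hF).1.ge.trans (hF (ih β.1 β.2))

/-- For ordinals in a universe large enough for the lattice, the increasing approximations reach
the least fixpoint, as they cannot be pairwise distinct. -/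
theorem exists_muInf_le_muApprox [Small.{o} L] (F : L → L) :
    ∃ γ : Ordinal.{o}, muInf F ≤ muApprox F γ := by
  have h := not_injective_of_ordinal (muApprox.{o} F)
  simp only [Function.Injective, not_forall] at h
  obtain ⟨α, β, he, hne⟩ := h
  wlog hlt : α < β generalizing α β
  · exact this β α he.symm (Ne.symm hne) (lt_of_le_of_ne (not_lt.1 hlt) (Ne.symm hne))
  refine ⟨α, sInf_le ?_⟩
  change F (muApprox F α) ≤ muApprox F α
  conv_rhs => rw [he, muApprox]
  exact le_iSup (fun δ : Set.Iio β => F (muApprox F δ.1)) ⟨α, hlt⟩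

theorem exists_nuApprox_le_nuInf [Small.{o} L] (F : L → L) :
    ∃ γ : Ordinal.{o}, nuApprox F γ ≤ nuInf F := by
  have h := not_injective_of_ordinal (nuApprox.{o} F)
  simp only [Function.Injective, not_forall] at h
  obtain ⟨α, β, he, hne⟩ := h
  wlog hlt : α < β generalizing α β
  · exact this β α he.symm (Ne.symm hne) (lt_of_le_of_ne (not_lt.1 hlt) (Ne.symm hne))
  refine ⟨α, le_sSup ?_⟩
  change nuApprox F α ≤ F (nuApprox F α)
  conv_lhs => rw [he, nuApprox]
  exact iInf_le (fun δ : Set.Iio β => F (nuApprox F δ.1)) ⟨α, hlt⟩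

/-- The least fixpoint `F^∞_μ` obeys the recursion of the approximations `F^α_μ`, if ordinals are
taken from a universe large enough for the lattice. -/
theorem approx_mu_eq_iSup [Small.{o} L] {F : L → L} (hF : Monotone F)
    (α : WithTop Ordinal.{o}) :
    approx .mu F α = ⨆ β : Set.Iio α, F (approx .mu F β.1) := by
  refine le_antisymm ?_ ?_
  · induction α with
    | top =>
      obtain ⟨γ, hγ⟩ := exists_muInf_le_muApprox.{o} F
      refine hγ.trans ?_
      rw [muApprox]
      exact iSup_le fun β => le_iSup
        (fun δ : Set.Iio (⊤ : WithTop Ordinal.{o}) => F (approx .mu F δ.1))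
        ⟨(β.1 : WithTop Ordinal.{o}), WithTop.coe_lt_top _⟩
    | coe α =>
      change muApprox F α ≤ _
      rw [muApprox]
      exact iSup_le fun β => le_iSup
        (fun δ : Set.Iio (α : WithTop Ordinal.{o}) => F (approx .mu F δ.1))
        ⟨(β.1 : WithTop Ordinal.{o}), WithTop.coe_lt_coe.2 β.2⟩
  · refine iSup_le ?_
    rintro ⟨β, hβ⟩
    lift β to Ordinal.{o} using hβ.ne_top
    induction α with
    | top => exact (hF (muApprox_le_muInf hF β)).trans (isLeast_muInf hF).1.le
    | coe α =>
      change F (muApprox F β) ≤ muApprox F α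
      conv_rhs => rw [muApprox]
      exact le_iSup (fun δ : Set.Iio α => F (muApprox F δ.1)) ⟨β, WithTop.coe_lt_coe.1 hβ⟩

theorem approx_nu_eq_iInf [Small.{o} L] {F : L → L} (hF : Monotone F)
    (α : WithTop Ordinal.{o}) :
    approx .nu F α = ⨅ β : Set.Iio α, F (approx .nu F β.1) := by
  refine le_antisymm ?_ ?_
  · refine le_iInf ?_
    rintro ⟨β, hβ⟩
    lift β to Ordinal.{o} using hβ.ne_top
    induction α with
    | top => exact (isGreatest_nuInf hF).1.ge.trans (hF (nuInf_le_nuApprox hF β))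
    | coe α =>
      change nuApprox F α ≤ F (nuApprox F β)
      conv_lhs => rw [nuApprox]
      exact iInf_le (fun δ : Set.Iio α => F (nuApprox F δ.1)) ⟨β, WithTop.coe_lt_coe.1 hβ⟩
  · induction α with
    | top =>
      obtain ⟨γ, hγ⟩ := exists_nuApprox_le_nuInf.{o} F
      refine le_trans ?_ hγ
      rw [nuApprox]
      exact le_iInf fun β => iInf_le
        (fun δ : Set.Iio (⊤ : WithTop Ordinal.{o}) => F (approx .nu F δ.1))
        ⟨(β.1 : WithTop Ordinal.{o}), WithTop.coe_lt_top _⟩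
    | coe α =>
      change _ ≤ nuApprox F α
      rw [nuApprox]
      exact le_iInf fun β => iInf_le
        (fun δ : Set.Iio (α : WithTop Ordinal.{o}) => F (approx .nu F δ.1))
        ⟨(β.1 : WithTop Ordinal.{o}), WithTop.coe_lt_coe.2 β.2⟩

theorem map_approx_top (η : FixKind) {F : L → L} (hF : Monotone F) :
    F (approx.{o} η F ⊤) = approx.{o} η F ⊤ := by
  cases η
  · exact (isLeast_muInf hF).1
  · exact (isGreatest_nuInf hF).1

theorem muApprox_lift (F : L → L) (α : Ordinal.{o}) :
    muApprox F (Ordinal.lift.{w} α) = muApprox F α := by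
  induction α using WellFoundedLT.induction with
  | ind α ih =>
    rw [muApprox, muApprox]
    refine le_antisymm (iSup_le ?_) (iSup_le fun β => ?_)
    · rintro ⟨β, hβ⟩
      obtain ⟨β, hlt, rfl⟩ := Ordinal.lt_lift_iff.1 hβ
      rw [ih β hlt]
      exact le_iSup (fun δ : Set.Iio α => F (muApprox F δ.1)) ⟨β, hlt⟩
    · rw [← ih β.1 β.2]
      exact le_iSup (fun δ : Set.Iio (Ordinal.lift.{w} α) => F (muApprox F δ.1))
        ⟨_, Ordinal.lift_lt.2 β.2⟩

theorem nuApprox_lift (F : L → L) (α : Ordinal.{o}) :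
    nuApprox F (Ordinal.lift.{w} α) = nuApprox F α := by
  induction α using WellFoundedLT.induction with
  | ind α ih =>
    rw [nuApprox, nuApprox]
    refine le_antisymm (le_iInf fun β => ?_) (le_iInf ?_)
    · rw [← ih β.1 β.2]
      exact iInf_le (fun δ : Set.Iio (Ordinal.lift.{w} α) => F (nuApprox F δ.1))
        ⟨_, Ordinal.lift_lt.2 β.2⟩
    · rintro ⟨β, hβ⟩
      obtain ⟨β, hlt, rfl⟩ := Ordinal.lt_lift_iff.1 hβ
      rw [ih β hlt]
      exact iInf_le (fun δ : Set.Iio α => F (nuApprox F δ.1)) ⟨β, hlt⟩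

theorem approx_lift (η : FixKind) (F : L → L) (α : WithTop Ordinal.{o}) :
    approx η F (α.map Ordinal.lift.{w}) = approx η F α := by
  cases η <;> cases α
  · rfl
  · exact muApprox_lift F _
  · rfl
  · exact nuApprox_lift F _

/-- Approximations commute with the restriction of vectors along `ι`: if `F` acts on the
components listed by `ι` as `G` does, then so do the approximations. -/
theorem approx_comp {V V' : Type*} (ι : V' → V) (η : FixKind) {F : (V → L) → V → L}
    {G : (V' → L) → V' → L} (hF : Monotone F) (hG : Monotone G)
    (h : ∀ X, F X ∘ ι = G (X ∘ ι)) (α : WithTop Ordinal.{o}) :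
    approx η F α ∘ ι = approx η G α := by
  cases η <;> cases α
  · refine le_antisymm (le_sInf fun a (ha : G a ≤ a) => ?_) (sInf_le ?_)
    · -- The largest vector whose restriction is below `a` is a prefixpoint of `F`.
      let s : V → L := fun v => ⨅ (v') (_ : ι v' = v), a v'
      have hs : s ∘ ι ≤ a := fun v' => iInf₂_le (f := fun x (_ : ι x = ι v') => a x) v' rfl
      have : muInf F ≤ s := by
        refine sInf_le fun v => le_iInf₂ ?_
        rintro v' rfl
        have h1 := congrFun (h s) v'
        simp only [Function.comp_apply] at h1
        rw [h1]
        exact (hG hs v').trans (ha v')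
      exact fun v' => (this (ι v')).trans (hs v')
    · change G (muInf F ∘ ι) ≤ muInf F ∘ ι
      rw [← h, (isLeast_muInf hF).1]
  · rename_i α
    change muApprox F α ∘ ι = muApprox G α
    induction α using WellFoundedLT.induction with
    | ind α ih =>
      rw [muApprox, muApprox]
      ext v'
      simp only [Function.comp_apply, iSup_apply]
      refine iSup_congr fun β => ?_
      rw [← ih β.1 β.2, ← h]
      rfl
  · refine le_antisymm (le_sSup ?_) (sSup_le fun a (ha : a ≤ G a) => ?_)
    · change nuInf F ∘ ι ≤ G (nuInf F ∘ ι)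
      rw [← h, (isGreatest_nuInf hF).1]
    · let s : V → L := fun v => ⨆ (v') (_ : ι v' = v), a v'
      have hs : a ≤ s ∘ ι := fun v' => le_iSup₂ (f := fun x (_ : ι x = ι v') => a x) v' rfl
      have : s ≤ nuInf F := by
        refine le_sSup fun v => iSup₂_le ?_
        rintro v' rfl
        have h1 := congrFun (h s) v'
        simp only [Function.comp_apply] at h1
        rw [h1]
        exact (ha v').trans (hG hs v')
      exact fun v' => (hs v').trans (this (ι v'))
  · rename_i α
    change nuApprox F α ∘ ι = nuApprox G α
    induction α using WellFoundedLT.induction with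
    | ind α ih =>
      rw [nuApprox, nuApprox]
      ext v'
      simp only [Function.comp_apply, iInf_apply]
      refine iInf_congr fun β => ?_
      rw [← ih β.1 β.2, ← h]
      rfl

end Approximations

/-! ### Nested systems of fixpoint equations -/

open Classical in
/-- The vector that agrees with `X` on the components of rank `r` and with `H` elsewhere. -/
noncomputable def overwrite {V R L : Type*} (rank : V → R) (r : R) (H X : V → L) : V → L :=
  fun v => if rank v = r then X v else H v

section Overwrite

variable {V R L : Type*} {rank : V → R} {r : R} {H X : V → L} {v : V}

theorem overwrite_of_eq (h : rank v = r) : overwrite rank r H X v = X v := if_pos h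

theorem overwrite_of_ne (h : rank v ≠ r) : overwrite rank r H X v = H v := if_neg h

theorem overwrite_mono [Preorder L] {H' X' : V → L} (hH : H ≤ H') (hX : X ≤ X') :
    overwrite rank r H X ≤ overwrite rank r H' X' := by
  intro v
  by_cases h : rank v = r
  · simpa [overwrite_of_eq h] using hX v
  · simpa [overwrite_of_ne h] using hH v

end Overwrite

/-- A system of equations `v = op v` over the lattice `L`, whose unknowns are ranked. Each rank
has a kind of fixpoint and a bound on the number of unfoldings (`⊤` for an unbounded one). -/
structure System (V R L : Type*) [CompleteLattice L] where
  /-- the rank of an unknown -/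
  rank : V → R
  /-- the kind of fixpoint taken at a rank -/
  kind : R → FixKind
  /-- the number of unfoldings granted to a rank -/
  bound : R → WithTop Ordinal.{o}
  /-- the right-hand sides of the equations -/
  op : (V → L) →o (V → L)

namespace System

variable {V R L : Type*} [CompleteLattice L]

/-- The nested solution of the unknowns with ranks in the list `l`, whose head is the outermost
rank, when the other unknowns take their values from `H`. Below `op`, all ranks have their full
bounds; outside of it, rank `r` has `e r` unfoldings left. -/
noncomputable def nested (S : System.{o} V R L) :
    List R → (R → WithTop Ordinal.{o}) → (V → L) → V → L
  | [], _, H => H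
  | r :: l, e, H => S.nested l e (overwrite S.rank r H
      (approx (S.kind r) (fun X => S.op (S.nested l S.bound (overwrite S.rank r H X))) (e r)))

variable (S : System.{o} V R L)

theorem nested_mono (l : List R) (e : R → WithTop Ordinal.{o}) : Monotone (S.nested l e) := by
  induction l generalizing e with
  | nil => exact monotone_id
  | cons r l ih =>
    intro H H' h
    refine ih e (overwrite_mono h (approx_mono _ ?_ ?_ ?_ _))
    · exact fun X Y hXY => S.op.monotone (ih _ (overwrite_mono le_rfl hXY))
    · exact fun X Y hXY => S.op.monotone (ih _ (overwrite_mono le_rfl hXY))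
    · exact fun X => S.op.monotone (ih _ (overwrite_mono h le_rfl))

/-- The operator whose approximations solve the unknowns of rank `r`, with those of ranks in `l`
nested inside. -/
noncomputable def level (l : List R) (r : R) (H : V → L) (X : V → L) : V → L :=
  S.op (S.nested l S.bound (overwrite S.rank r H X))

theorem level_mono (l : List R) (r : R) (H : V → L) : Monotone (S.level l r H) :=
  fun _ _ h => S.op.monotone (S.nested_mono _ _ (overwrite_mono le_rfl h))

theorem nested_cons (r : R) (l : List R) (e : R → WithTop Ordinal.{o}) (H : V → L) :
    S.nested (r :: l) e H =
      S.nested l e (overwrite S.rank r H (approx (S.kind r) (S.level l r H) (e r))) := rfl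

theorem nested_apply_of_notMem {l : List R} (e : R → WithTop Ordinal.{o}) (H : V → L) {v : V}
    (hv : S.rank v ∉ l) : S.nested l e H v = H v := by
  induction l generalizing H with
  | nil => rfl
  | cons r l ih =>
    simp only [List.mem_cons, not_or] at hv
    rw [nested_cons, ih _ hv.2, overwrite_of_ne hv.1]

theorem nested_congr_left {l : List R} {e e' : R → WithTop Ordinal.{o}} (H : V → L)
    (h : ∀ r ∈ l, e r = e' r) : S.nested l e H = S.nested l e' H := by
  induction l generalizing H with
  | nil => rfl
  | cons r l ih =>
    rw [nested_cons, nested_cons, h r (by simp), ih _ fun s hs => h s (by simp [hs])]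

/-- Unfolding of the nested solution at an unknown of rank `r`. Once the numbers of unfoldings of
the ranks above `r` are fixed, the solution at rank `r` is an approximation of some operator `G`,
and if moreover the ranks below `r` have their full bounds, then one step of `op` is `G`. -/
theorem exists_nested_eq_approx [LinearOrder R] {l : List R} (hl : l.Pairwise (· > ·)) {r : R}
    (hr : r ∈ l) (e : R → WithTop Ordinal.{o}) (H : V → L) :
    ∃ G : (V → L) → V → L, Monotone G ∧ ∀ e' : R → WithTop Ordinal.{o},
      (∀ s, r < s → e' s = e s) →
      (∀ v, S.rank v = r → S.nested l e' H v = approx (S.kind r) G (e' r) v) ∧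
      ((∀ s, s < r → e' s = S.bound s) →
        S.op (S.nested l e' H) = G (approx (S.kind r) G (e' r))) := by
  induction l generalizing H with
  | nil => simp at hr
  | cons t l ih =>
    rw [List.pairwise_cons] at hl
    rcases eq_or_ne r t with rfl | hne
    · have hrl : r ∉ l := fun h => lt_irrefl _ (hl.1 r h)
      refine ⟨S.level l r H, S.level_mono l r H, fun e' _ => ⟨fun v hv => ?_, fun hlow => ?_⟩⟩
      · rw [nested_cons, nested_apply_of_notMem _ _ _ (hv ▸ hrl), overwrite_of_eq hv]
      · rw [nested_cons, S.nested_congr_left _ fun s hs => hlow s (hl.1 s hs)]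
        rfl
    · have hrl : r ∈ l := (List.mem_cons.1 hr).resolve_left hne
      obtain ⟨G, hG, h⟩ := ih hl.2 hrl
        (overwrite S.rank t H (approx (S.kind t) (S.level l t H) (e t)))
      refine ⟨G, hG, fun e' he' => ?_⟩
      rw [nested_cons, he' t (hl.1 r hrl)]
      exact h e' he'

/-- The counter values after the counter of rank `r` is set to `β` and the lower ones are
reset. -/
def update {R : Type*} [LinearOrder R] (bound e : R → WithTop Ordinal.{o}) (r : R)
    (β : WithTop Ordinal.{o}) : R → WithTop Ordinal.{o} :=
  fun s => if s < r then bound s else if s = r then β else e s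

section Update

variable {R : Type*} [LinearOrder R] {bound e : R → WithTop Ordinal.{o}} {r s : R}
  {β : WithTop Ordinal.{o}}

theorem update_of_lt (h : s < r) : update bound e r β s = bound s := if_pos h

theorem update_self : update bound e r β r = β := by simp [update]

theorem update_of_gt (h : r < s) : update bound e r β s = e s := by
  simp [update, h.not_gt, h.ne']

end Update

section Unfold

variable [LinearOrder R] {l : List R} (hl : l.Pairwise (· > ·)) (e : R → WithTop Ordinal.{o})
  (H : V → L) {v : V} (hv : S.rank v ∈ l)
include hl hv

theorem nested_apply_mu [Small.{o} (V → L)] (hk : S.kind (S.rank v) = .mu) :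
    S.nested l e H v = ⨆ β : Set.Iio (e (S.rank v)),
      S.op (S.nested l (update S.bound e (S.rank v) β.1) H) v := by
  obtain ⟨G, hG, h⟩ := S.exists_nested_eq_approx hl hv e H
  rw [(h e fun _ _ => rfl).1 v rfl, hk, approx_mu_eq_iSup hG, iSup_apply]
  refine iSup_congr fun β => ?_
  rw [(h _ fun s hs => update_of_gt hs).2 fun s hs => update_of_lt hs, update_self, hk]

theorem nested_apply_nu [Small.{o} (V → L)] (hk : S.kind (S.rank v) = .nu) :
    S.nested l e H v = ⨅ β : Set.Iio (e (S.rank v)),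
      S.op (S.nested l (update S.bound e (S.rank v) β.1) H) v := by
  obtain ⟨G, hG, h⟩ := S.exists_nested_eq_approx hl hv e H
  rw [(h e fun _ _ => rfl).1 v rfl, hk, approx_nu_eq_iInf hG, iInf_apply]
  refine iInf_congr fun β => ?_
  rw [(h _ fun s hs => update_of_gt hs).2 fun s hs => update_of_lt hs, update_self, hk]

theorem nested_apply_top (ht : e (S.rank v) = ⊤) :
    S.nested l e H v = S.op (S.nested l (update S.bound e (S.rank v) ⊤) H) v := by
  obtain ⟨G, hG, h⟩ := S.exists_nested_eq_approx hl hv e H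
  rw [(h e fun _ _ => rfl).1 v rfl,
    (h _ fun s hs => update_of_gt hs).2 fun s hs => update_of_lt hs, update_self, ht,
    map_approx_top _ hG]

end Unfold

/-- The same system, with bounds in a larger universe. -/
noncomputable def lift : System.{max o w} V R L where
  rank := S.rank
  kind := S.kind
  bound r := (S.bound r).map Ordinal.lift.{w}
  op := S.op

theorem nested_lift (l : List R) (e : R → WithTop Ordinal.{o}) (H : V → L) :
    (lift.{o, w} S).nested l (fun r => (e r).map Ordinal.lift.{w}) H = S.nested l e H := by
  induction l generalizing e H with
  | nil => rfl
  | cons r l ih =>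
    have : (lift.{o, w} S).level l r H = S.level l r H := funext fun X => congrArg S.op (ih _ _)
    rw [nested_cons, nested_cons, ← ih, this]
    change (lift.{o, w} S).nested l _ (overwrite _ _ _ (approx _ _ ((e r).map _))) = _
    rw [approx_lift]
    rfl

/-- Locality of nested solutions. Suppose that the unknowns of `S'` are embedded in those of `S`
by `ι`, with ranks matched by the partial map `proj`, and that on their equations `S` acts as
`S'` does, as long as the unknowns listed by `f`, which are not solved for, have the values `X`.
Then the nested solution of `S` restricts to that of `S'`. -/
theorem nested_comp {V' R' J : Type*} (S' : System.{o} V' R' L) (ι : V' → V) (f : J → V)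
    (proj : R → Option R') (hproj : ∀ r v', S.rank (ι v') = r ↔ proj r = some (S'.rank v'))
    (hkind : ∀ r r', proj r = some r' → S.kind r = S'.kind r' ∧ S.bound r = S'.bound r')
    {l : List R} (hf : ∀ j, S.rank (f j) ∉ l) (X : J → L)
    (hop : ∀ H, (∀ j, H (f j) = X j) → S.op H ∘ ι = S'.op (H ∘ ι))
    (H : V → L) (hH : ∀ j, H (f j) = X j) :
    S.nested l S.bound H ∘ ι = S'.nested (l.filterMap proj) S'.bound (H ∘ ι) := by
  induction l generalizing H with
  | nil => rfl
  | cons r l ih =>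
    have hf' : ∀ j, S.rank (f j) ∉ l := fun j h => hf j (List.mem_cons_of_mem _ h)
    have hfr : ∀ Y j, overwrite S.rank r H Y (f j) = X j := fun Y j => by
      rw [overwrite_of_ne fun h => hf j (by simp [h]), hH]
    rw [nested_cons, ih hf' _ (hfr _)]
    rcases hr : proj r with _ | r'
    · rw [List.filterMap_cons_none hr]
      congr 1
      ext1 v'
      refine overwrite_of_ne fun h => ?_
      simp [(hproj r v').1 h] at hr
    · have hov : ∀ Y, overwrite S.rank r H Y ∘ ι = overwrite S'.rank r' (H ∘ ι) (Y ∘ ι) := by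
        refine fun Y => funext fun v' => ?_
        by_cases h : S'.rank v' = r'
        · rw [overwrite_of_eq h]
          exact overwrite_of_eq ((hproj r v').2 (by rw [hr, h]))
        · rw [overwrite_of_ne h]
          refine overwrite_of_ne fun h' => h ?_
          rw [(hproj r v').1 h', Option.some_inj] at hr
          exact hr
      rw [List.filterMap_cons_some hr, nested_cons, hov, (hkind r r' hr).1, (hkind r r' hr).2,
        approx_comp ι _ (S.level_mono l r H) (S'.level_mono (l.filterMap proj) r' (H ∘ ι))]
      intro Y
      rw [level, level, ← hov, ← ih hf' _ (hfr _), hop]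
      intro j
      rw [S.nested_apply_of_notMem _ _ (hf' j), hfr]

end System

/-! ### Winning strategies from virtual counters -/

namespace Game

variable {V R : Type*}

/-- The counter valuation of a configuration. -/
def Config.ctr {G : Game.{o} V R} : G.Config → G.nonstd → Ordinal.{o}
  | .positional _ ctr => ctr
  | .countdown _ ctr => ctr

variable [LinearOrder R] {G : Game.{o} V R}

section Plays

variable {P : Player} {σ : G.Strategy} {γ : G.Config}

theorem IsPlay.inv {π : List G.Config} {c c' : G.Config}
    (h : G.IsPlay P σ γ (π ++ [c] ++ [c'])) :
    G.IsPlay P σ γ (π ++ [c]) ∧ G.Move c c' ∧ (c.mover = P → σ (π ++ [c]) = some c') := by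
  generalize hρ : π ++ [c] ++ [c'] = ρ at h
  cases h with
  | start => simpa using congrArg List.length hρ
  | @step π' d d' h1 h2 h3 =>
    obtain ⟨h4, h5⟩ := List.append_inj' hρ rfl
    obtain ⟨h6, h7⟩ := List.append_inj' h4 rfl
    simp only [List.cons.injEq, and_true] at h5 h7
    subst h5 h6 h7
    exact ⟨h1, h2, h3⟩

theorem range_succ_map {α : Type*} (f : ℕ → α) (n : ℕ) :
    (List.range (n + 1)).map f = (List.range n).map f ++ [f n] := by
  rw [List.range_succ, List.map_append, List.map_singleton]

theorem IsInfinitePlay.step {f : ℕ → G.Config} (h : IsInfinitePlay P σ γ f) (n : ℕ) :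
    G.Move (f n) (f (n + 1)) ∧
      ((f n).mover = P → σ ((List.range n).map f ++ [f n]) = some (f (n + 1))) := by
  have h1 := h (n + 1)
  rw [range_succ_map, range_succ_map] at h1
  exact h1.inv.2

end Plays

/-- The two players cannot both win: playing winning strategies against each other gives an
infinite play that both would win. -/
theorem not_wins_both {γ : G.Config} (hE : G.Wins .eve γ) (hA : G.Wins .adam γ) : False := by
  obtain ⟨σ, hσ, hσ'⟩ := hE
  obtain ⟨τ, hτ, hτ'⟩ := hA
  let Both : List G.Config → G.Config → Prop := fun π c =>
    G.IsPlay .eve σ γ (π ++ [c]) ∧ G.IsPlay .adam τ γ (π ++ [c])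
  have hnext : ∀ x : {x : List G.Config × G.Config // Both x.1 x.2},
      ∃ c', Both (x.1.1 ++ [x.1.2]) c' := by
    rintro ⟨⟨π, c⟩, h1, h2⟩
    rcases hm : c.mover with _ | _
    · obtain ⟨c', hc, hs⟩ := hσ π c h1 hm
      exact ⟨c', h1.step hc fun _ => hs, h2.step hc fun h => by simp [hm] at h⟩
    · obtain ⟨c', hc, hs⟩ := hτ π c h2 hm
      exact ⟨c', h1.step hc fun h => by simp [hm] at h, h2.step hc fun _ => hs⟩
  choose nxt hnxt using hnext
  let seq : ℕ → {x : List G.Config × G.Config // Both x.1 x.2} := fun n =>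
    Nat.rec ⟨([], γ), .start, .start⟩ (fun _ x => ⟨(x.1.1 ++ [x.1.2], nxt x), hnxt x⟩) n
  let f : ℕ → G.Config := fun n => (seq n).1.2
  have hseq : ∀ n, (List.range n).map f = (seq n).1.1 := by
    intro n
    induction n with
    | zero => rfl
    | succ n ih =>
      rw [range_succ_map, ih]
  have hf : ∀ n, (List.range (n + 1)).map f = (seq n).1.1 ++ [(seq n).1.2] := fun n => by
    rw [range_succ_map, hseq]
  obtain ⟨r, hr, hrE⟩ := hσ' f fun n => by rw [hf]; exact (seq n).2.1
  obtain ⟨r', hr', hrA⟩ := hτ' f fun n => by rw [hf]; exact (seq n).2.2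
  obtain rfl := hr.unique hr'
  rcases h : G.rankOwner r with _ | _
  · exact hrE h
  · exact hrA h

open Classical in
/-- The part of a counter valuation at ranks `≥ r`, ordered lexicographically with the greatest
rank as the most significant one. -/
noncomputable def upper (r : R) (e : R → WithTop Ordinal.{w}) :
    Colex (R → WithTop Ordinal.{w}) :=
  toColex fun s => if r ≤ s then e s else 0

theorem upper_le_upper [Finite R] {e e' : R → WithTop Ordinal.{w}} (h : toColex e ≤ toColex e')
    (r : R) : upper r e ≤ upper r e' := by
  rcases h.eq_or_lt with h | ⟨s, hs, hlt⟩
  · rw [show e = e' from h]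
  · by_cases hr : r ≤ s
    · refine le_of_lt ⟨s, fun t ht => ?_, ?_⟩
      · have := hs t ht
        simp only [Pi.toColex_apply] at this
        simp [upper, this]
      · simpa [upper, hr] using hlt
    · refine le_of_eq (funext fun t => ?_)
      change (if r ≤ t then e t else 0) = (if r ≤ t then e' t else 0)
      split_ifs with ht
      · exact hs t ((not_le.1 hr).trans_le ht)
      · rfl

section Update

variable {bound e : R → WithTop Ordinal.{w}} {r s : R} {β : WithTop Ordinal.{w}}

theorem upper_update_le (h : s ≤ r) (hβ : s = r → β ≤ e r) :
    upper r (System.update bound e s β) ≤ upper r e := by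
  have : ∀ t, r < t → System.update bound e s β t = e t :=
    fun t ht => System.update_of_gt (h.trans_lt ht)
  rcases h.lt_or_eq with h | rfl
  · refine le_of_eq (funext fun t => ?_)
    change (if r ≤ t then _ else 0) = (if r ≤ t then e t else 0)
    split_ifs with ht
    · exact System.update_of_gt (h.trans_le ht)
    · rfl
  · rcases (hβ rfl).lt_or_eq with hlt | heq
    · refine le_of_lt ⟨s, fun t ht => ?_, ?_⟩
      · simp [upper, this t ht]
      · simpa [upper, System.update_self] using hlt
    · refine le_of_eq (funext fun t => ?_)
      change (if s ≤ t then _ else 0) = (if s ≤ t then e t else 0)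
      split_ifs with ht
      · rcases ht.lt_or_eq with ht | rfl
        · exact this t ht
        · rw [System.update_self, heq]
      · rfl

theorem upper_update_lt (hβ : β < e r) :
    upper r (System.update bound e r β) < upper r e :=
  ⟨r, fun t ht => by simp [upper, System.update_of_gt ht],
    by simpa [upper, System.update_self] using hβ⟩

end Update

/-- A sufficient condition for player `P` to win, in terms of virtual counters. These extend the
actual counters by counters for the standard ranks, with values possibly in a larger universe.
`Good e v` is thought of as "`P` wins from the countdown configuration at `v` with virtual
counters `e`", and is required to be locally consistent. At a standard rank, `P` has to decrement
the virtual counter if `P` owns the rank, while the opponent leaves it as it is. -/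
structure Certificate (G : Game.{o} V R) (P : Player)
    (bound : R → WithTop Ordinal.{max o w})
    (Good : (R → WithTop Ordinal.{max o w}) → V → Prop) : Prop where
  bound_eq : ∀ s : G.nonstd, bound s = (Ordinal.lift.{w} (G.ctrI s) : Ordinal.{max o w})
  own : ∀ e v, Good e v → G.rankOwner (G.rank v) = P → ∃ β < e (G.rank v),
    (G.owner v = P → ∃ v', G.edge v v' ∧ Good (System.update bound e (G.rank v) β) v') ∧
    (G.owner v ≠ P → ∀ v', G.edge v v' → Good (System.update bound e (G.rank v) β) v')
  other : ∀ e v, Good e v → G.rankOwner (G.rank v) ≠ P →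
    ∀ β, (G.rank v ∈ G.nonstd → β < e (G.rank v)) →
      (G.rank v ∉ G.nonstd → β = e (G.rank v)) →
    (G.owner v = P → ∃ v', G.edge v v' ∧ Good (System.update bound e (G.rank v) β) v') ∧
    (G.owner v ≠ P → ∀ v', G.edge v v' → Good (System.update bound e (G.rank v) β) v')

section Certificate

variable (G) in
/-- `e` extends the actual counters `ctr`. -/
def Extends (e : R → WithTop Ordinal.{max o w}) (ctr : G.nonstd → Ordinal.{o}) : Prop :=
  ∀ s : G.nonstd, e s = (Ordinal.lift.{w} (ctr s) : Ordinal.{max o w})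

/-- `e` is a virtual counter valuation that witnesses that the configuration is won by `P`. -/
def Witness (P : Player) (Good : (R → WithTop Ordinal.{max o w}) → V → Prop) (c : G.Config)
    (e : R → WithTop Ordinal.{max o w}) : Prop :=
  Extends.{o, w} G e c.ctr ∧ match c with
    | .positional v _ =>
      (G.owner v = P → ∃ v', G.edge v v' ∧ Good e v') ∧
      (G.owner v ≠ P → ∀ v', G.edge v v' → Good e v')
    | .countdown v _ => Good e v

/-- The virtual counters `e` of `c` may become `e'` after a move: they do not change in positional
configurations, and in countdown configurations they are updated at the rank of `c`, with a strict
decrease if `P` owns this rank. -/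
def Progress (P : Player) (bound : R → WithTop Ordinal.{max o w}) (c : G.Config)
    (e e' : R → WithTop Ordinal.{max o w}) : Prop :=
  match c with
  | .positional _ _ => e' = e
  | .countdown v _ => ∃ β ≤ e (G.rank v), (G.rankOwner (G.rank v) = P → β < e (G.rank v)) ∧
      e' = System.update bound e (G.rank v) β

variable {P : Player} {bound : R → WithTop Ordinal.{max o w}}
  {Good : (R → WithTop Ordinal.{max o w}) → V → Prop}

theorem Certificate.extends_update (h : Certificate.{o, w} G P bound Good)
    {e : R → WithTop Ordinal.{max o w}} {r : R} {β : WithTop Ordinal.{max o w}}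
    {ctr ctr' : G.nonstd → Ordinal.{o}} (he : Extends.{o, w} G e ctr)
    (hu : G.CtrUpdate r ctr ctr')
    (hβ : ∀ hr : r ∈ G.nonstd, β = (Ordinal.lift.{w} (ctr' ⟨r, hr⟩) : Ordinal.{max o w})) :
    Extends.{o, w} G (System.update bound e r β) ctr' := by
  rintro ⟨s, hs⟩
  rcases lt_trichotomy s r with hlt | rfl | hgt
  · rw [System.update_of_lt hlt, (hu ⟨s, hs⟩).1 hlt]
    exact h.bound_eq ⟨s, hs⟩
  · rw [System.update_self, hβ hs]
  · rw [System.update_of_gt hgt, (hu ⟨s, hs⟩).2.2 hgt]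
    exact he ⟨s, hs⟩

open Classical in
theorem Certificate.step_own (h : Certificate.{o, w} G P bound Good) {c : G.Config}
    {e : R → WithTop Ordinal.{max o w}} (he : Witness P Good c e) (hc : c.mover = P) :
    ∃ c' e', G.Move c c' ∧ Witness P Good c' e' ∧ Progress P bound c e e' := by
  rcases c with ⟨v, ctr⟩ | ⟨v, ctr⟩
  · obtain ⟨v', hv, hg⟩ := he.2.1 hc
    exact ⟨.countdown v' ctr, e, .edge hv, ⟨he.1, hg⟩, rfl⟩
  · obtain ⟨β, hβ, hg⟩ := h.own e v he.2 hc
    -- At a nonstandard rank the virtual counter is an actual one, hence so is `β`.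
    have hβ' : ∀ hr : G.rank v ∈ G.nonstd, ∃ β' < ctr ⟨_, hr⟩,
        β = (Ordinal.lift.{w} β' : Ordinal.{max o w}) := by
      intro hr
      have h1 := he.1 ⟨_, hr⟩
      simp only [Config.ctr] at h1
      rw [h1] at hβ
      lift β to Ordinal.{max o w} using hβ.ne_top
      obtain ⟨β', hlt, h2⟩ := Ordinal.lt_lift_iff.1 (WithTop.coe_lt_coe.1 hβ)
      exact ⟨β', hlt, by rw [h2]⟩
    let ctr' : G.nonstd → Ordinal.{o} := fun s =>
      if s.1 < G.rank v then G.ctrI s else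
      if hs : s.1 = G.rank v then (hβ' (hs ▸ s.2)).choose else ctr s
    have hu : G.CtrUpdate (G.rank v) ctr ctr' := by
      rintro ⟨s, hs⟩
      refine ⟨fun hlt => if_pos hlt, ?_, fun hgt => ?_⟩
      · rintro rfl
        simp only [ctr', lt_irrefl, if_false, dite_true]
        exact (hβ' hs).choose_spec.1
      · simp only [ctr']
        rw [if_neg hgt.not_gt, dif_neg hgt.ne']
    refine ⟨.positional v ctr', System.update bound e (G.rank v) β, .count hu,
      ⟨h.extends_update he.1 hu fun hr => ?_, hg⟩, β, hβ.le, fun _ => hβ, rfl⟩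
    simp only [Config.ctr, ctr', lt_irrefl, if_false, dite_true]
    exact (hβ' hr).choose_spec.2

theorem Certificate.step_other (h : Certificate.{o, w} G P bound Good) {c c' : G.Config}
    {e : R → WithTop Ordinal.{max o w}} (he : Witness P Good c e) (hc : c.mover ≠ P)
    (hm : G.Move c c') : ∃ e', Witness P Good c' e' ∧ Progress P bound c e e' := by
  classical
  cases hm with
  | edge hv => exact ⟨e, ⟨he.1, he.2.2 hc _ hv⟩, rfl⟩
  | @count v ctr ctr' hu =>
    let β : WithTop Ordinal.{max o w} := if hr : G.rank v ∈ G.nonstd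
      then (Ordinal.lift.{w} (ctr' ⟨_, hr⟩) : Ordinal.{max o w}) else e (G.rank v)
    have hβ : G.rank v ∈ G.nonstd → β < e (G.rank v) := by
      intro hr
      have h1 := he.1 ⟨_, hr⟩
      simp only [Config.ctr] at h1
      simp only [β, dif_pos hr]
      rw [h1, WithTop.coe_lt_coe, Ordinal.lift_lt]
      exact (hu ⟨_, hr⟩).2.1 rfl
    have hβ' : G.rank v ∉ G.nonstd → β = e (G.rank v) := fun hr => dif_neg hr
    refine ⟨System.update bound e (G.rank v) β,
      ⟨h.extends_update he.1 hu fun hr => dif_pos hr, h.other e v he.2 hc β hβ hβ'⟩, β, ?_,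
      fun ho => absurd ho hc, rfl⟩
    by_cases hr : G.rank v ∈ G.nonstd
    · exact (hβ hr).le
    · exact (hβ' hr).le

/-- If for a rank `r` owned by `P` the virtual counters progress at each move and no rank above `r`
occurs from some point on, then `r` occurs only finitely often. -/
theorem not_frequently_of_progress [Finite R] {f : ℕ → G.Config}
    (hf : ∀ n, G.Move (f n) (f (n + 1)))
    {ρ : ℕ → R → WithTop Ordinal.{max o w}}
    (hρ : ∀ n, ∃ e, Progress P bound (f n) (ρ n) e ∧ toColex (ρ (n + 1)) ≤ toColex e) {r : R}
    (hr : G.rankOwner r = P) {N : ℕ} (hN : ∀ n ≥ N, G.rank (f n).pos ≤ r) :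
    ¬ ∃ᶠ n in Filter.atTop, G.rank (f n).pos = r := by
  intro hfreq
  have hle : ∀ n ≥ N, upper r (ρ (n + 1)) ≤ upper r (ρ n) := by
    intro n hn
    obtain ⟨e, he, hle⟩ := hρ n
    refine (upper_le_upper hle r).trans ?_
    have h1 := hN n hn
    rcases hc : f n with ⟨v, ctr⟩ | ⟨v, ctr⟩
    · rw [hc] at he
      exact le_of_eq (congrArg _ he)
    · rw [hc] at he h1
      obtain ⟨β, hβ, -, rfl⟩ := he
      exact upper_update_le h1 fun h => h ▸ hβ
  have hlt : ∀ n v ctr, f n = .countdown v ctr → G.rank v = r →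
      upper r (ρ (n + 1)) < upper r (ρ n) := by
    intro n v ctr hc hv
    obtain ⟨e, he, hle⟩ := hρ n
    refine (upper_le_upper hle r).trans_lt ?_
    rw [hc] at he
    obtain ⟨β, -, hβ, rfl⟩ := he
    subst hv
    exact upper_update_lt (hβ hr)
  obtain ⟨k, hk⟩ := WellFoundedLT.antitone_chain_condition
    (antitone_nat_of_succ_le (f := fun n => upper r (ρ (N + n))) fun n => hle (N + n) (by omega))
  have hconst : ∀ n ≥ N + k, upper r (ρ (n + 1)) = upper r (ρ n) := by
    intro n hn
    have h1 := hk (n - N) (by omega)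
    have h2 := hk (n + 1 - N) (by omega)
    rw [show N + (n - N) = n by omega] at h1
    rw [show N + (n + 1 - N) = n + 1 by omega] at h2
    exact h2.symm.trans h1
  obtain ⟨n, hn, hnr⟩ := Filter.frequently_atTop.1 hfreq (N + k + 1)
  -- A positional configuration is entered from the countdown configuration at the same position.
  rcases hc : f n with ⟨v, ctr⟩ | ⟨v, ctr⟩
  · obtain ⟨n, rfl⟩ : ∃ m, n = m + 1 := ⟨n - 1, by omega⟩
    have hm := hf n
    rw [hc] at hm hnr
    generalize hd : f n = d at hm
    cases hm with
    | count hu => exact (hlt n v _ hd hnr).ne (hconst n (by omega))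
  · rw [hc] at hnr
    exact (hlt n v ctr hc hnr).ne (hconst n (by omega))

/-- The strategy of `P` keeps the virtual counters lexicographically least among those that
witness that the present configuration is won. -/
theorem Certificate.wins [Finite R] (h : Certificate.{o, w} G P bound Good) {c₀ : G.Config}
    {e₀ : R → WithTop Ordinal.{max o w}} (h₀ : Witness P Good c₀ e₀) : G.Wins P c₀ := by
  classical
  have hmin : ∀ c : G.Config, ∃ e, (∃ e', Witness P Good c e') → Witness P Good c e ∧
      ∀ e', Witness P Good c e' → toColex e ≤ toColex e' := by
    intro c
    by_cases hc : ∃ e', Witness P Good c e'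
    · obtain ⟨e, he, hmin⟩ := WellFounded.has_min
        (wellFounded_lt (α := Colex (R → WithTop Ordinal.{max o w})))
        {e | Witness P Good c (ofColex e)} hc
      exact ⟨ofColex e, fun _ => ⟨he, fun e' he' => not_lt.1 (hmin (toColex e') he')⟩⟩
    · exact ⟨bound, fun h => absurd h hc⟩
  choose ρ hρ using hmin
  have hnext : ∀ c : G.Config, ∃ c', (∃ e, Witness P Good c e) → c.mover = P →
      ∃ e', G.Move c c' ∧ Witness P Good c' e' ∧ Progress P bound c (ρ c) e' := by
    intro c
    by_cases hc : (∃ e, Witness P Good c e) ∧ c.mover = P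
    · obtain ⟨c', e', hce⟩ := h.step_own (hρ c hc.1).1 hc.2
      exact ⟨c', fun _ _ => ⟨e', hce⟩⟩
    · exact ⟨c, fun h1 h2 => absurd ⟨h1, h2⟩ hc⟩
  choose nxt hnxt using hnext
  let σ : G.Strategy := fun π => π.getLast?.map nxt
  have hσ : ∀ π c, σ (π ++ [c]) = some (nxt c) := fun π c => by simp [σ]
  have hstep : ∀ c c' : G.Config, (∃ e, Witness P Good c e) → G.Move c c' →
      (c.mover = P → c' = nxt c) →
      ∃ e', Witness P Good c' e' ∧ Progress P bound c (ρ c) e' := by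
    intro c c' hc hm hcc
    by_cases hP : c.mover = P
    · obtain ⟨e', -, h1⟩ := hnxt c hc hP
      exact ⟨e', hcc hP ▸ h1⟩
    · exact h.step_other (hρ c hc).1 hP hm
  have hplay : ∀ π, G.IsPlay P σ c₀ π → ∀ c, π.getLast? = some c →
      ∃ e, Witness P Good c e := by
    intro π hπ
    induction hπ with
    | start =>
      rintro c hc
      obtain rfl : c₀ = c := by simpa using hc
      exact ⟨_, h₀⟩
    | @step π c c' _ hm hs ih =>
      intro d hd
      obtain rfl : c' = d := by simpa using hd
      obtain ⟨e', he', -⟩ := hstep c c' (ih c (by simp)) hm fun hP => by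
        have := hs hP
        rw [hσ] at this
        exact (Option.some_inj.1 this).symm
      exact ⟨e', he'⟩
  refine ⟨σ, fun π c hπ hc => ?_, fun f hf => ?_⟩
  · obtain ⟨e', hm, -⟩ := hnxt c (hplay _ hπ c (by simp)) hc
    exact ⟨nxt c, hm, hσ π c⟩
  · have hw : ∀ n, ∃ e, Witness P Good (f n) e := fun n =>
      hplay _ (hf n) _ (by rw [range_succ_map]; simp)
    have hprog : ∀ n, ∃ e, Progress P bound (f n) (ρ (f n)) e ∧
        toColex (ρ (f (n + 1))) ≤ toColex e := by
      intro n
      obtain ⟨hm, hs⟩ := hf.step n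
      obtain ⟨e, he, hpr⟩ := hstep _ _ (hw n) hm fun hP => by
        have := hs hP
        rw [hσ] at this
        exact (Option.some_inj.1 this).symm
      exact ⟨e, hpr, (hρ _ (hw (n + 1))).2 e he⟩
    -- Some rank occurs infinitely often, since there are only finitely many.
    let I : Set R := {s | ∃ᶠ n in Filter.atTop, G.rank (f n).pos = s}
    have hI : I.Nonempty := by
      by_contra hne
      have h1 : ∀ s : R, ∀ᶠ n in Filter.atTop, G.rank (f n).pos ≠ s := by
        intro s
        by_contra hs
        exact hne ⟨s, fun hs' => hs hs'⟩
      obtain ⟨n, hn⟩ := (Filter.eventually_all.2 h1).exists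
      exact hn _ rfl
    obtain ⟨r, hr⟩ := Set.exists_max_image I id I.toFinite hI
    have hgr : IsGreatest I r := ⟨hr.1, fun s hs => hr.2 s hs⟩
    refine ⟨r, hgr, fun hrP => ?_⟩
    have h1 : ∀ s : R, ∀ᶠ n in Filter.atTop, r < s → G.rank (f n).pos ≠ s := by
      intro s
      by_cases hs : r < s
      · have : s ∉ I := fun h => (hgr.2 h).not_gt hs
        filter_upwards [Filter.not_frequently.1 this] with n hn _ using hn
      · exact Filter.Eventually.of_forall fun n h => absurd h hs
    obtain ⟨N, hN⟩ := Filter.eventually_atTop.1 (Filter.eventually_all.2 h1)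
    exact not_frequently_of_progress (fun n => (hf.step n).1) hprog hrP
      (fun n hn => not_lt.1 fun hlt => hN n hn _ hlt rfl) hgr.1

end Certificate

end Game

/-! ### Languages of automata as nested solutions -/

/-- The fixpoint taken at the ranks owned by a player: a player loses if a rank of theirs is the
greatest one that recurs forever, so Eve's ranks are unfolded inductively. -/
def Player.kind : Player → FixKind
  | .eve => .mu
  | .adam => .nu

namespace Automaton

variable {Act Var R : Type*} {Q : Type u} {M : Type w}

open Classical in
/-- The initial counter value of a rank, which is `⊤` for standard ranks. -/
noncomputable def bound (A : Automaton.{o} Act Var Q R) (r : R) : WithTop Ordinal.{o} :=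
  if h : r ∈ A.nonstd then (A.ctrI ⟨r, h⟩ : WithTop Ordinal.{o}) else ⊤

/-- The points from which Eve wins in state `q` before an edge is chosen, if she wins after it in
the positions described by `X` for states and by `val` for variables. -/
def stepOp (A : Automaton.{o} Act Var Q R) (step : Act → M → M → Prop) (val : Var → Set M)
    (X : Q → Set M) (q : Q) : Set M :=
  {m | match A.owner q with
    | .eve => ∃ v, A.GameEdge step (m, .inl q) v ∧ v.1 ∈ Sum.elim X val v.2
    | .adam => ∀ v, A.GameEdge step (m, .inl q) v → v.1 ∈ Sum.elim X val v.2}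

theorem elim_mono {X Y : Q → Set M} {val val' : Var → Set M} (h : X ≤ Y) (hv : val ≤ val')
    (z : Q ⊕ Var) : Sum.elim X val z ⊆ Sum.elim Y val' z := by
  cases z
  · exact h _
  · exact hv _

theorem stepOp_mono (A : Automaton.{o} Act Var Q R) (step : Act → M → M → Prop)
    {X Y : Q → Set M} {val val' : Var → Set M} (h : X ≤ Y) (hv : val ≤ val') :
    A.stepOp step val X ≤ A.stepOp step val' Y := by
  intro q m hm
  simp only [stepOp, Set.mem_ofPred_eq] at hm ⊢
  cases hq : A.owner q <;> rw [hq] at hm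
  · obtain ⟨v, hv', hm⟩ := hm
    exact ⟨v, hv', elim_mono h hv _ hm⟩
  · exact fun v hv' => elim_mono h hv _ (hm v hv')

/-- The system of equations of an automaton. -/
noncomputable def system (A : Automaton.{o} Act Var Q R) (step : Act → M → M → Prop)
    (val : Var → Set M) : System.{o} Q R (Set M) where
  rank := A.rank
  kind r := (A.rankOwner r).kind
  bound := A.bound
  op := ⟨A.stepOp step val, fun _ _ h => A.stepOp_mono step h le_rfl⟩

section Language

variable (A : Automaton.{o} Act Var Q R) (step : Act → M → M → Prop) (val : Var → Set M)

theorem coe_mem_nonstd {r : R} : (r : WithBot R) ∈ (A.game step val).nonstd ↔ r ∈ A.nonstd :=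
  ⟨fun h => h.2, fun h => ⟨WithBot.coe_ne_bot, h⟩⟩

theorem bot_notMem_nonstd : (⊥ : WithBot R) ∉ (A.game step val).nonstd := fun h => h.1 rfl

/-- The initial values of the virtual counters in the semantic game. -/
noncomputable def virtualBound (A : Automaton.{o} Act Var Q R) :
    WithBot R → WithTop Ordinal.{max o u w}
  | ⊥ => ⊤
  | (r : R) => (A.bound r).map Ordinal.lift.{max u w}

theorem update_virtualBound [LinearOrder R] (e : WithBot R → WithTop Ordinal.{max o u w}) (r : R)
    (β : WithTop Ordinal.{max o u w}) :
    (fun s : R => System.update (virtualBound.{o, w, u} A) e r β s) =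
      System.update (System.lift.{o, max u w} (A.system step val)).bound
        (fun s : R => e s) r β := by
  ext1 s
  simp only [System.update, WithBot.coe_lt_coe, WithBot.coe_inj]
  rfl

/-- The invariant of player `P` in the semantic game: according to the nested solution, in which
`v.1` belongs to the value at `v.2` if Eve is the winner, the position `v` with virtual counters `e`
is won by `P`. The counters of `⊥` and of the opponent's standard ranks have not been touched. -/
def Good (l : List R) (H : Q → Set M) (P : Player) (e : WithBot R → WithTop Ordinal.{max o u w})
    (v : M × (Q ⊕ Var)) : Prop :=
  e ⊥ = ⊤ ∧ (∀ r : R, r ∉ A.nonstd → A.rankOwner r ≠ P → e r = ⊤) ∧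
    (P = .eve ↔ v.1 ∈ Sum.elim
      ((System.lift.{o, max u w} (A.system step val)).nested l (fun r => e r) H) val v.2)

variable {A step val}

theorem edge_of_mem_stepOp_iff {P : Player} {m : M} {q : Q} {X : Q → Set M}
    (h : P = .eve ↔ m ∈ A.stepOp step val X q) :
    (A.owner q = P → ∃ v, A.GameEdge step (m, .inl q) v ∧
      (P = .eve ↔ v.1 ∈ Sum.elim X val v.2)) ∧
    (A.owner q ≠ P → ∀ v, A.GameEdge step (m, .inl q) v →
      (P = .eve ↔ v.1 ∈ Sum.elim X val v.2)) := by
  simp only [stepOp, Set.mem_ofPred_eq] at h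
  cases hq : A.owner q <;> rw [hq] at h <;> cases P <;>
    simpa [-Prod.exists, -Prod.forall] using h

theorem Good.update [LinearOrder R] {l : List R} {H : Q → Set M} {P : Player}
    {e : WithBot R → WithTop Ordinal.{max o u w}} {m : M} {q : Q}
    (h : Good A step val l H P e (m, .inl q)) {β : WithTop Ordinal.{max o u w}}
    (hβ : A.rankOwner (A.rank q) ≠ P → A.rank q ∉ A.nonstd → β = ⊤)
    (hm : P = .eve ↔ m ∈ A.stepOp step val
      ((System.lift.{o, max u w} (A.system step val)).nested l
        (System.update (System.lift.{o, max u w} (A.system step val)).bound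
        (fun s : R => e s) (A.rank q) β) H) q) :
    (A.owner q = P → ∃ v, A.GameEdge step (m, .inl q) v ∧
      Good A step val l H P (System.update (virtualBound.{o, w, u} A) e (A.rank q) β) v) ∧
    (A.owner q ≠ P → ∀ v, A.GameEdge step (m, .inl q) v →
      Good A step val l H P (System.update (virtualBound.{o, w, u} A) e (A.rank q) β) v) := by
  have h1 : System.update (virtualBound.{o, w, u} A) e (A.rank q) β ⊥ = ⊤ :=
    System.update_of_lt (WithBot.bot_lt_coe _)
  have h2 : ∀ r : R, r ∉ A.nonstd → A.rankOwner r ≠ P →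
      System.update (virtualBound.{o, w, u} A) e (A.rank q) β r = ⊤ := by
    intro r hr hP
    rcases lt_trichotomy r (A.rank q) with hlt | rfl | hgt
    · rw [System.update_of_lt (WithBot.coe_lt_coe.2 hlt)]
      simp [virtualBound, bound, hr]
    · rw [System.update_self]
      exact hβ hP hr
    · rw [System.update_of_gt (WithBot.coe_lt_coe.2 hgt)]
      exact h.2.1 r hr hP
  obtain ⟨h3, h4⟩ := edge_of_mem_stepOp_iff hm
  rw [← update_virtualBound A step val] at h3 h4
  refine ⟨fun ho => ?_, fun ho v hv => ⟨h1, h2, h4 ho v hv⟩⟩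
  obtain ⟨v, hv, hg⟩ := h3 ho
  exact ⟨v, hv, h1, h2, hg⟩

theorem not_edge_inr {m : M} {x : Var} {v : M × (Q ⊕ Var)} :
    ¬ A.GameEdge step (m, .inr x) v := by
  intro h
  cases h

variable (A step val) in
theorem certificate [LinearOrder R] {l : List R} (hl : l.Pairwise (· > ·)) (hc : ∀ r, r ∈ l)
    (H : Q → Set M) (P : Player) : Game.Certificate.{o, max u w} (A.game step val) P
      (virtualBound.{o, w, u} A) (Good A step val l H P) := by
  classical
  have : Small.{max o u w} (Q → Set M) := small_max.{o} _
  let S := System.lift.{o, max u w} (A.system step val)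
  constructor
  · rintro ⟨s, hs⟩
    induction s with
    | bot => exact absurd hs (bot_notMem_nonstd A step val)
    | coe r =>
      change (A.bound r).map _ = _
      rw [bound, dif_pos ((coe_mem_nonstd A step val).1 hs)]
      rfl
  · rintro e ⟨m, q | x⟩ hg hP
    · change A.rankOwner (A.rank q) = P at hP
      have hβ : ∃ β < e (A.rank q), (P = .eve ↔ m ∈ A.stepOp step val
          (S.nested l (System.update S.bound (fun s : R => e s) (A.rank q) β) H) q) := by
        have hm : P = .eve ↔ m ∈ S.nested l (fun r => e r) H q := hg.2.2
        cases P
        · have hk : S.kind (S.rank q) = .mu := by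
            change (A.rankOwner (A.rank q)).kind = _
            rw [hP]; rfl
          have := hm.1 rfl
          rw [S.nested_apply_mu hl _ H (hc _) hk] at this
          obtain ⟨⟨β, hβ⟩, hm⟩ := Set.mem_iUnion.1 this
          exact ⟨β, hβ, fun _ => hm, fun _ => rfl⟩
        · have hk : S.kind (S.rank q) = .nu := by
            change (A.rankOwner (A.rank q)).kind = _
            rw [hP]; rfl
          have : m ∉ S.nested l (fun r => e r) H q := fun h => by simpa using hm.2 h
          rw [S.nested_apply_nu hl _ H (hc _) hk] at this
          obtain ⟨⟨β, hβ⟩, hm⟩ := not_forall.1 fun h => this (Set.mem_iInter.2 h)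
          exact ⟨β, hβ, fun h => by simp at h, fun h => absurd h hm⟩
      obtain ⟨β, hlt, hm⟩ := hβ
      exact ⟨β, hlt, hg.update (fun h => absurd hP h) hm⟩
    · -- Adam decrements the unbounded virtual counter of the rank `⊥`, and then Eve is stuck.
      obtain rfl : Player.adam = P := hP
      refine ⟨0, ?_, fun ho => ?_, fun _ v hv => absurd hv not_edge_inr⟩
      · change 0 < e ⊥
        rw [hg.1]
        exact WithTop.coe_lt_top 0
      · have : m ∉ val x := fun h => by simpa using hg.2.2.2 h
        simp [game, this] at ho
  · rintro e ⟨m, q | x⟩ hg hP β hβ hβ'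
    · change A.rankOwner (A.rank q) ≠ P at hP
      change ((A.rank q : WithBot R) ∈ _ → β < e (A.rank q)) at hβ
      change ((A.rank q : WithBot R) ∉ _ → β = e (A.rank q)) at hβ'
      rw [coe_mem_nonstd] at hβ hβ'
      refine hg.update (fun h1 h2 => (hβ' h2).trans (hg.2.1 _ h2 h1)) ?_
      have hm : P = .eve ↔ m ∈ S.nested l (fun r => e r) H q := hg.2.2
      by_cases hr : A.rank q ∈ A.nonstd
      · cases P
        · have hk : S.kind (S.rank q) = .nu := by
            change (A.rankOwner (A.rank q)).kind = _
            cases h : A.rankOwner (A.rank q)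
            · exact absurd h hP
            · rfl
          have := hm.1 rfl
          rw [S.nested_apply_nu hl _ H (hc _) hk] at this
          exact ⟨fun _ => Set.mem_iInter.1 this ⟨β, hβ hr⟩, fun _ => rfl⟩
        · have hk : S.kind (S.rank q) = .mu := by
            change (A.rankOwner (A.rank q)).kind = _
            cases h : A.rankOwner (A.rank q)
            · rfl
            · exact absurd h hP
          have : m ∉ S.nested l (fun r => e r) H q := fun h => by simpa using hm.2 h
          rw [S.nested_apply_mu hl _ H (hc _) hk] at this
          exact ⟨fun h => by simp at h,
            fun h => absurd (Set.mem_iUnion.2 ⟨⟨β, hβ hr⟩, h⟩) this⟩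
      · have ht := hg.2.1 _ hr hP
        rw [hβ' hr, ht]
        rw [S.nested_apply_top hl _ H (hc _) ht] at hm
        exact hm
    · refine ⟨fun ho => ?_, fun _ v hv => absurd hv not_edge_inr⟩
      obtain rfl : Player.eve = P := by
        cases P
        · rfl
        · exact absurd rfl hP
      have : m ∈ val x := hg.2.2.1 rfl
      simp [game, this] at ho

variable (A step val) in
/-- The language of an automaton is the value at the initial state of the nested solution of its
system, after one step as the initial configuration is positional. If a point is in this set, then
Eve wins, otherwise Adam wins. -/
theorem language_eq [LinearOrder R] [Finite R] {l : List R} (hl : l.Pairwise (· > ·)) (hc : ∀ r, r ∈ l)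
    (H : Q → Set M) :
    A.language step val =
      A.stepOp step val ((A.system step val).nested l A.bound H) A.init := by
  have key : ∀ (P : Player) m,
      (P = .eve ↔ m ∈ A.stepOp step val ((A.system step val).nested l A.bound H) A.init) →
      (A.game step val).Wins P (.positional (m, .inl A.init) (A.game step val).ctrI) := by
    intro P m hm
    have hcert := certificate.{o, w, u} A step val hl hc H P
    refine hcert.wins (e₀ := virtualBound.{o, w, u} A) ⟨hcert.bound_eq, ?_⟩
    rw [← System.nested_lift.{o, max u w}] at hm
    have h2 : ∀ r : R, r ∉ A.nonstd → A.rankOwner r ≠ P → virtualBound.{o, w, u} A r = ⊤ := by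
      intro r hr _
      simp [virtualBound, bound, hr]
    obtain ⟨h3, h4⟩ := edge_of_mem_stepOp_iff hm
    refine ⟨fun ho => ?_, fun ho v hv => ⟨rfl, h2, h4 ho v hv⟩⟩
    obtain ⟨v, hv, hg⟩ := h3 ho
    exact ⟨v, hv, rfl, h2, hg⟩
  ext m
  refine ⟨fun hw => ?_, fun hm => key .eve m ⟨fun _ => hm, fun _ => rfl⟩⟩
  by_contra hm
  exact Game.not_wins_both hw (key .adam m ⟨fun h => by simp at h, fun h => absurd h hm⟩)

end Language

end Automaton

theorem exists_descending_list (R : Type*) [LinearOrder R] [Finite R] :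
    ∃ l : List R, l.Pairwise (· > ·) ∧ ∀ r, r ∈ l := by
  have := Fintype.ofFinite R
  refine ⟨((Finset.univ : Finset R).sort).reverse, ?_, fun r => by simp⟩
  rw [List.pairwise_reverse]
  exact (Finset.sortedLT_sort _).pairwise

/-! ### One step of an automaton -/

/-- The points from which the player `P` wins a single move along the transition `D`, if `T`
describes the positions won by Eve after the move. -/
def stepSet {Act M Z : Type*} (step : Act → M → M → Prop) (T : Z → Set M) :
    Player → Finset Z ⊕ (Act × Z) → Set M
  | .eve, .inl S => {m | ∃ z ∈ S, m ∈ T z}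
  | .adam, .inl S => {m | ∀ z ∈ S, m ∈ T z}
  | .eve, .inr (τ, z) => {m | ∃ n, step τ m n ∧ n ∈ T z}
  | .adam, .inr (τ, z) => {m | ∀ n, step τ m n → n ∈ T z}

open Classical in
/-- The image of a transition under a map of targets. -/
noncomputable def mapTarget {Act Z Z' : Type*} (t : Z → Z') :
    Finset Z ⊕ (Act × Z) → Finset Z' ⊕ (Act × Z')
  | .inl S => .inl (S.image t)
  | .inr (τ, z) => .inr (τ, t z)

theorem stepSet_mapTarget {Act M Z Z' : Type*} (step : Act → M → M → Prop) (t : Z → Z')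
    (T : Z' → Set M) (P : Player) (D : Finset Z ⊕ (Act × Z)) :
    stepSet step T P (mapTarget t D) = stepSet step (T ∘ t) P D := by
  rcases D with S | ⟨τ, z⟩ <;> cases P <;> simp [mapTarget, stepSet]

namespace Automaton

variable {Act Var R : Type*} {Q : Type u} {M : Type w}

theorem stepOp_eq_stepSet (A : Automaton.{o} Act Var Q R) (step : Act → M → M → Prop)
    (val : Var → Set M) (X : Q → Set M) (q : Q) :
    A.stepOp step val X q = stepSet step (Sum.elim X val) (A.owner q) (A.delta q) := by
  have hedge : ∀ m v, A.GameEdge step (m, .inl q) v ↔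
      (∃ S, A.delta q = .inl S ∧ v.1 = m ∧ v.2 ∈ S) ∨
      ∃ τ, A.delta q = .inr (τ, v.2) ∧ step τ m v.1 := by
    rintro m ⟨n, z⟩
    constructor
    · rintro (⟨h1, h2⟩ | ⟨h1, h2⟩)
      · exact .inl ⟨_, h1, rfl, h2⟩
      · exact .inr ⟨_, h1, h2⟩
    · rintro (⟨S, h1, h2, h3⟩ | ⟨τ, h1, h2⟩)
      · obtain rfl : n = m := h2
        exact .eps h1 h3
      · exact .modal h1 h2
  ext m
  simp only [stepOp, Set.mem_ofPred_eq, hedge]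
  rcases A.delta q with S | ⟨τ, z⟩ <;> cases A.owner q <;> simp [stepSet, -Sum.exists, -Sum.forall]
  exact ⟨fun h z hz => h m z rfl hz, fun h n z hn hz => hn ▸ h z hz⟩

end Automaton

/-! ### From automata to formulas -/

namespace Formula

variable {Act Var : Type*} {M : Type w}

/-- Disjunction of a list of formulas. -/
def disj (l : List (Formula.{o} Act Var)) : Formula.{o} Act Var := l.foldr .or .bot

/-- Conjunction of a list of formulas. -/
def conj (l : List (Formula.{o} Act Var)) : Formula.{o} Act Var := l.foldr .and .top

theorem mem_sem_disj {step : Act → M → M → Prop} {val : Var → Set M} {m : M}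
    {l : List (Formula.{o} Act Var)} :
    m ∈ (disj l).sem step val ↔ ∃ φ ∈ l, m ∈ φ.sem step val := by
  induction l with
  | nil => simp [disj, sem]
  | cons φ l ih =>
    change m ∈ φ.sem step val ∪ (disj l).sem step val ↔ _
    simp [ih]

theorem mem_sem_conj {step : Act → M → M → Prop} {val : Var → Set M} {m : M}
    {l : List (Formula.{o} Act Var)} :
    m ∈ (conj l).sem step val ↔ ∀ φ ∈ l, m ∈ φ.sem step val := by
  induction l with
  | nil => simp [conj, sem]
  | cons φ l ih =>
    change m ∈ φ.sem step val ∩ (conj l).sem step val ↔ _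
    simp [ih]

/-- The formula that expresses one move along a transition, if `ψ` expresses the targets. -/
noncomputable def ofTransition {Z : Type*} (ψ : Z → Formula.{o} Act Var) :
    Player → Finset Z ⊕ (Act × Z) → Formula.{o} Act Var
  | .eve, .inl S => disj (S.toList.map ψ)
  | .adam, .inl S => conj (S.toList.map ψ)
  | .eve, .inr (τ, z) => .dia τ (ψ z)
  | .adam, .inr (τ, z) => .box τ (ψ z)

theorem sem_ofTransition {Z : Type*} (ψ : Z → Formula.{o} Act Var) (P : Player)
    (D : Finset Z ⊕ (Act × Z)) (step : Act → M → M → Prop) (val : Var → Set M) :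
    (ofTransition ψ P D).sem step val = stepSet step (fun z => (ψ z).sem step val) P D := by
  rcases D with S | ⟨τ, z⟩ <;> cases P <;> ext m <;>
    simp [ofTransition, stepSet, mem_sem_disj, mem_sem_conj, sem]

end Formula

namespace Automaton

variable {Act Var R : Type*} {Q : Type u} (A : Automaton.{o} Act Var Q R)

/-- The variables in the transitions of an automaton. -/
def vars : Set Var :=
  {x | ∃ q, (∃ S, A.delta q = .inl S ∧ .inr x ∈ S) ∨ ∃ τ, A.delta q = .inr (τ, .inr x)}

theorem finite_vars [Finite Q] : A.vars.Finite := by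
  have : A.vars = ⋃ q, {x | (∃ S, A.delta q = .inl S ∧ .inr x ∈ S) ∨
      ∃ τ, A.delta q = .inr (τ, .inr x)} := by
    ext x
    simp [vars]
  rw [this]
  refine Set.finite_iUnion fun q => ?_
  rcases A.delta q with S | ⟨τ, z⟩
  · refine ((S.finite_toSet).preimage (f := .inr) Sum.inr_injective.injOn).subset ?_
    rintro x (⟨S', h, hx⟩ | ⟨τ, h⟩)
    · obtain rfl := Sum.inl_injective h
      exact hx
    · simp at h
  · refine ((Set.finite_singleton z).preimage (f := .inr) Sum.inr_injective.injOn).subset ?_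
    rintro x (⟨S', h, hx⟩ | ⟨τ, h⟩)
    · simp at h
    · simp only [Sum.inr.injEq, Prod.mk.injEq] at h
      exact h.2.symm

theorem system_congr {M : Type w} (step : Act → M → M → Prop) {val val' : Var → Set M}
    (h : ∀ x ∈ A.vars, val x = val' x) : A.system step val = A.system step val' := by
  have : A.stepOp step val = A.stepOp step val' := by
    funext X q
    rw [stepOp_eq_stepSet, stepOp_eq_stepSet]
    rcases hD : A.delta q with S | ⟨τ, z⟩
    · have hS : ∀ z ∈ S, Sum.elim X val z = Sum.elim X val' z := by
        rintro (p | x) hz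
        · rfl
        · exact h x ⟨q, .inl ⟨S, hD, hz⟩⟩
      cases A.owner q <;> ext m <;> simp only [stepSet, Set.mem_ofPred_eq]
      · exact exists_congr fun z => and_congr_right fun hz => by rw [hS z hz]
      · exact forall₂_congr fun z hz => by rw [hS z hz]
    · have hz : Sum.elim X val z = Sum.elim X val' z := by
        rcases z with p | x
        · rfl
        · exact h x ⟨q, .inr ⟨τ, hD⟩⟩
      cases A.owner q <;> simp only [stepSet, hz]
  simp only [system, this]

/-- The formula for one step of the automaton from `q`, if `ψ` expresses the states. -/
noncomputable def stepFormula (ψ : Q → Formula.{o} Act Var) (q : Q) : Formula.{o} Act Var :=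
  .ofTransition (Sum.elim ψ .var) (A.owner q) (A.delta q)

theorem sem_stepFormula {M : Type w} (ψ : Q → Formula.{o} Act Var) (q : Q)
    (step : Act → M → M → Prop) (val : Var → Set M) :
    (A.stepFormula ψ q).sem step val =
      A.stepOp step val (fun p => (ψ p).sem step val) q := by
  rw [stepFormula, Formula.sem_ofTransition, stepOp_eq_stepSet]
  congr 1
  funext z
  cases z <;> rfl

/-- Nested solutions are expressed by formulas, where a fresh variable `x q` stands for the
parameter at the state `q`. The values at the rank `r` form a vectorial fixpoint over the
variables of this rank. To plug them into the formula for the other ranks without substitution,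
another fixpoint operator binds those variables again: as a system in which no equation but the one
for a fresh variable `z` has free occurrences of the bound variables. -/
theorem exists_formula_nested [Finite Q] {x : Q → Var} (hx : Function.Injective x)
    (hxA : ∀ q, x q ∉ A.vars) {z : Var} (hz : z ∉ A.vars) (hxz : ∀ q, x q ≠ z) (l : List R) :
    ∃ ψ : Q → Formula.{o} Act Var, ∀ (M : Type w) (step : Act → M → M → Prop)
      (val : Var → Set M) (q : Q), (ψ q).sem step val =
        (A.system step val).nested l A.bound (fun p => val (x p)) q := by
  induction l with
  | nil => exact ⟨fun q => .var (x q), fun M step val q => rfl⟩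
  | cons r l ih =>
    obtain ⟨ψ, hψ⟩ := ih
    let ε := (Finite.equivFin {q // A.rank q = r}).symm
    set n := Nat.card {q // A.rank q = r}
    let ι : Fin n → Q := fun i => (ε i).1
    have hι : Function.Injective ι := Subtype.val_injective.comp ε.injective
    have hιr : ∀ i, A.rank (ι i) = r := fun i => (ε i).2
    have hιs : ∀ q, A.rank q = r → ∃ i, ι i = q := fun q hq =>
      ⟨ε.symm ⟨q, hq⟩, by simp [ι]⟩
    let y : Fin n ↪ Var := ⟨fun i => x (ι i), hx.comp hι⟩
    let y' : Fin (n + 1) ↪ Var := ⟨Fin.cons z y, Fin.cons_injective_iff.2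
      ⟨by rintro ⟨i, hi⟩; exact hxz _ hi, y.injective⟩⟩
    let θ : Fin n → Formula.{o} Act Var := fun i =>
      .fix (A.rankOwner r).kind (A.bound r) y (fun j => A.stepFormula ψ (ι j)) i
    have hθ : ∀ (M : Type w) (step : Act → M → M → Prop) (val : Var → Set M) (i : Fin n),
        (θ i).sem step val = approx (A.rankOwner r).kind
          ((A.system step val).level l r fun p => val (x p)) (A.bound r) (ι i) := by
      intro M step val i
      refine (congrFun (approx_comp ι (A.rankOwner r).kind
        ((A.system step val).level_mono l r fun p => val (x p)) ?_ ?_ (A.bound r)) i).symm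
      · exact fun H H' hH j => Formula.sem_mono step _ (extend_mono y hH le_rfl)
      · intro X
        funext j
        set val' := Function.extend y (X ∘ ι) val with hval'
        rw [sem_stepFormula]
        simp only [hψ]
        have h1 : A.system step val' = A.system step val := by
          refine A.system_congr step fun v hv => ?_
          rw [hval', Function.extend_apply']
          rintro ⟨i, rfl⟩
          exact hxA _ hv
        have h2 : (fun p => val' (x p)) = overwrite A.rank r (fun p => val (x p)) X := by
          funext p
          by_cases hp : A.rank p = r
          · rw [overwrite_of_eq hp]
            obtain ⟨i, rfl⟩ := hιs p hp
            exact y.injective.extend_apply _ _ i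
          · rw [overwrite_of_ne hp, hval', Function.extend_apply']
            rintro ⟨i, hi⟩
            exact hp (hx hi ▸ hιr i)
        have h3 : A.stepOp step val' = (A.system step val).op := by rw [← h1]; rfl
        rw [h1, h2, h3]
        rfl
    refine ⟨fun q => .fix .mu ⊤ y' (Fin.cons (ψ q) θ) 0, fun M step val q => ?_⟩
    -- The components of the fixpoint `T` are read off from the equation `G T = T`.
    let G : (Fin (n + 1) → Set M) → Fin (n + 1) → Set M := fun H j =>
      (Fin.cons (α := fun _ => Formula.{o} Act Var) (ψ q) θ j).sem step
        (Function.extend y' H val)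
    have hGm : Monotone G := fun H H' hH j =>
      Formula.sem_mono step _ (extend_mono y' hH le_rfl)
    have hG : G (muInf G) = muInf G := (isLeast_muInf hGm).1
    change muInf G 0 = _
    set T := muInf G
    set val' := Function.extend y' T val with hval'
    have hv0 : ∀ v, v ≠ z → (∀ i, x (ι i) ≠ v) → val' v = val v := by
      intro v h1 h2
      rw [hval', Function.extend_apply']
      rintro ⟨i, hi⟩
      refine Fin.cases (fun h => h1 h.symm) (fun j h => h2 j h) i hi
    have hT : ∀ i : Fin n, val' (x (ι i)) = T i.succ := fun i =>
      y'.injective.extend_apply T val i.succ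
    have h1 : A.system step val' = A.system step val := by
      refine A.system_congr step fun v hv => hv0 v ?_ fun i => ?_
      · rintro rfl; exact hz hv
      · rintro rfl; exact hxA _ hv
    have hne : ∀ p, A.rank p ≠ r → val' (x p) = val (x p) := fun p hp =>
      hv0 _ (hxz p) fun i hi => hp (hx hi ▸ hιr i)
    have h2 : ∀ X, overwrite A.rank r (fun p => val' (x p)) X =
        overwrite A.rank r (fun p => val (x p)) X := by
      intro X
      funext p
      by_cases hp : A.rank p = r
      · rw [overwrite_of_eq hp, overwrite_of_eq hp]
      · rw [overwrite_of_ne hp, overwrite_of_ne hp, hne p hp]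
    have h3 : ∀ i : Fin n, T i.succ = approx (A.rankOwner r).kind
        ((A.system step val).level l r fun p => val (x p)) (A.bound r) (ι i) := by
      intro i
      rw [← hG]
      change (θ i).sem step val' = _
      rw [hθ, h1]
      exact congrArg (fun F : (Q → Set M) → Q → Set M =>
        approx (A.rankOwner r).kind F (A.bound r) (ι i)) (funext fun X =>
        congrArg (fun H => (A.system step val).op
          ((A.system step val).nested l A.bound H)) (h2 X))
    rw [← hG]
    change (ψ q).sem step val' = _
    rw [hψ, h1, System.nested_cons]
    congr 1
    funext p
    by_cases hp : A.rank p = r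
    · refine Eq.trans ?_ (overwrite_of_eq hp).symm
      obtain ⟨i, rfl⟩ := hιs p hp
      rw [hT, h3]
      rfl
    · exact (hne p hp).trans 
        (overwrite_of_ne (rank := A.rank) (H := fun p => val (x p)) hp).symm

theorem exists_formula [Infinite Var] [Finite Q] [LinearOrder R] [Finite R] :
    ∃ φ : Formula.{o} Act Var, ∀ (M : Type w) (step : Act → M → M → Prop) (val : Var → Set M),
      A.language step val = φ.sem step val := by
  obtain ⟨l, hl, hc⟩ := exists_descending_list R
  have := A.finite_vars.infinite_compl.to_subtype
  let x : Option Q ↪ ↥(A.vars)ᶜ := (Finite.equivFin (Option Q)).toEmbedding.trans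
    (Fin.valEmbedding.trans (Infinite.natEmbedding _))
  obtain ⟨ψ, hψ⟩ := A.exists_formula_nested (x := fun q => (x (some q)).1) (z := (x none).1)
    (fun p q h => by simpa using x.injective (Subtype.ext h)) (fun q => (x (some q)).2) (x none).2
    (fun q h => by simpa using x.injective (Subtype.ext h)) l
  refine ⟨A.stepFormula ψ A.init, fun M step val => ?_⟩
  rw [sem_stepFormula, language_eq A step val hl hc fun p => val (x (some p)).1]
  exact congrArg (fun X => A.stepOp step val X A.init) (funext fun p => (hψ M step val p).symm)

end Automaton

/-! ### From formulas to automata -/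

/-- A finite automaton together with its types of states and ranks. -/
structure FiniteAutomaton (Act Var : Type*) where
  /-- the states -/
  Q : Type
  /-- the ranks -/
  R : Type
  [finiteQ : Finite Q]
  [linearOrderR : LinearOrder R]
  [finiteR : Finite R]
  /-- the automaton -/
  aut : Automaton.{o} Act Var Q R

attribute [instance] FiniteAutomaton.finiteQ FiniteAutomaton.linearOrderR FiniteAutomaton.finiteR

/-- The owner of the ranks at which a fixpoint of the given kind is taken. -/
def FixKind.player : FixKind → Player
  | .mu => .eve
  | .nu => .adam

theorem FixKind.kind_player (η : FixKind) : η.player.kind = η := by cases η <;> rfl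

namespace Combine

variable {Act Var : Type*} {n : ℕ} (B : Fin n → FiniteAutomaton.{o} Act Var)

/-- The states of a combination of automata: a new initial state, a state `entry j` to enter the
`j`-th automaton, and the states `inner j q` of the automata. -/
abbrev State : Type := Option (Fin n ⊕ Σ j, (B j).Q)

/-- The ranks of a combination of automata: a new greatest rank, and below it the ranks of the
automata, where those of different automata are ordered arbitrarily. -/
abbrev Rank : Type := WithTop (Σₗ j, (B j).R)

instance : Finite (Σₗ j, (B j).R) := inferInstanceAs (Finite (Σ j, (B j).R))

variable {B}

/-- The state to enter the `j`-th automaton. -/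
def entry (j : Fin n) : State B := some (.inl j)

/-- The state `q` of the `j`-th automaton. -/
def inner (j : Fin n) (q : (B j).Q) : State B := some (.inr ⟨j, q⟩)

/-- The rank `r` of the `j`-th automaton. -/
def innerRank (j : Fin n) (r : (B j).R) : Rank B := ((toLex ⟨j, r⟩ : Σₗ j, (B j).R) : Rank B)

/-- Targets of the transitions in the `j`-th automaton, when the variables in the domain of the
partial map `sub` are replaced by entry states. -/
def target (sub : Var → Option (Fin n)) (j : Fin n) : (B j).Q ⊕ Var → State B ⊕ Var
  | .inl q => .inl (inner j q)
  | .inr x => match sub x with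
    | some i => .inl (entry i)
    | none => .inr x

/-- The valuation in which the variables in the domain of `sub` are replaced by the vector `Y`. -/
def subst {M : Type w} (sub : Var → Option (Fin n)) (val : Var → Set M) (Y : Fin n → Set M) :
    Var → Set M :=
  fun x => match sub x with
    | some i => Y i
    | none => val x

variable (B) in
/-- The initial counter values of a combination of automata. -/
noncomputable def bound (α : WithTop Ordinal.{o}) : Rank B → WithTop Ordinal.{o}
  | ⊤ => α
  | WithTop.some r => (B (ofLex r).1).aut.bound (ofLex r).2

variable (B) in
/-- The combination of automata that first takes the transition `D` to the entries of the automata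
`B j` or to variables. Whenever one of the automata reaches a variable `x` with `sub x = some i`,
the `i`-th automaton is entered anew. Entry states have the greatest rank, of kind `η` and with
initial counter value `α`. They have the transitions of the initial states of the automata, as the
rank of the initial state must not be visited on entry. -/
noncomputable def combine (η : FixKind) (α : WithTop Ordinal.{o}) (sub : Var → Option (Fin n))
    (P : Player) (D : Finset (Fin n ⊕ Var) ⊕ (Act × (Fin n ⊕ Var))) :
    Automaton.{o} Act Var (State B) (Rank B) where
  owner
    | none => P
    | some (.inl j) => (B j).aut.owner (B j).aut.init
    | some (.inr ⟨j, q⟩) => (B j).aut.owner q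
  init := none
  delta
    | none => mapTarget (Sum.map entry id) D
    | some (.inl j) => mapTarget (target sub j) ((B j).aut.delta (B j).aut.init)
    | some (.inr ⟨j, q⟩) => mapTarget (target sub j) ((B j).aut.delta q)
  rank
    | none => ⊤
    | some (.inl _) => ⊤
    | some (.inr ⟨j, q⟩) => innerRank j ((B j).aut.rank q)
  rankOwner
    | ⊤ => η.player
    | WithTop.some r => (B (ofLex r).1).aut.rankOwner (ofLex r).2
  nonstd := {r | bound B α r ≠ ⊤}
  ctrI r := (bound B α r.1).untop r.2

section

variable {η : FixKind} {α : WithTop Ordinal.{o}} {sub : Var → Option (Fin n)} {P : Player}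
  {D : Finset (Fin n ⊕ Var) ⊕ (Act × (Fin n ⊕ Var))} {M : Type w} {step : Act → M → M → Prop}
  {val : Var → Set M}

theorem combine_bound : (combine B η α sub P D).bound = bound B α := by
  funext r
  by_cases h : bound B α r = ⊤
  · rw [Automaton.bound, dif_neg (by simpa [combine] using h), h]
  · rw [Automaton.bound, dif_pos (show r ∈ (combine B η α sub P D).nonstd from h)]
    exact WithTop.coe_untop _ h

theorem elim_target (Y : State B → Set M) (j : Fin n) :
    Sum.elim Y val ∘ target sub j =
      Sum.elim (Y ∘ inner j) (subst sub val (Y ∘ entry)) := by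
  funext z
  rcases z with q | x
  · rfl
  · simp only [Function.comp_apply, target, Sum.elim_inr, subst]
    rcases sub x with _ | i <;> rfl

theorem stepOp_entry (Y : State B → Set M) (j : Fin n) :
    (combine B η α sub P D).stepOp step val Y (entry j) =
      (B j).aut.stepOp step (subst sub val (Y ∘ entry)) (Y ∘ inner j) (B j).aut.init := by
  rw [Automaton.stepOp_eq_stepSet, Automaton.stepOp_eq_stepSet, ← elim_target]
  exact stepSet_mapTarget _ _ _ _ _

theorem stepOp_inner (Y : State B → Set M) (j : Fin n) (q : (B j).Q) :
    (combine B η α sub P D).stepOp step val Y (inner j q) =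
      (B j).aut.stepOp step (subst sub val (Y ∘ entry)) (Y ∘ inner j) q := by
  rw [Automaton.stepOp_eq_stepSet, Automaton.stepOp_eq_stepSet, ← elim_target]
  exact stepSet_mapTarget _ _ _ _ _

theorem innerRank_strictMono (j : Fin n) : StrictMono (innerRank (B := B) j) :=
  fun _ _ h => WithTop.coe_lt_coe.2 (Sigma.Lex.right _ _ h)

theorem language_combine {T : (Fin n → Set M) → Fin n → Set M} (hT : Monotone T)
    (hB : ∀ Y j, (B j).aut.language step (subst sub val Y) = T Y j) :
    (combine B η α sub P D).language step val =
      stepSet step (Sum.elim (approx η T α) val) P D := by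
  classical
  obtain ⟨l₀, hl₀, hc₀⟩ := exists_descending_list (Σₗ j, (B j).R)
  let l : List (Rank B) := l₀.map (↑)
  have hl : l.Pairwise (· > ·) := List.pairwise_map.2
    (hl₀.imp fun h => WithTop.coe_lt_coe.2 h)
  have htop : ⊤ ∉ l := by simp [l]
  have hc : ∀ r : Σₗ j, (B j).R, (r : Rank B) ∈ l := fun r => List.mem_map_of_mem (hc₀ r)
  let A := combine B η α sub P D
  let S := A.system step val
  let H : State B → Set M := fun _ => ∅
  have hlang : A.language step val = A.stepOp step val (S.nested (⊤ :: l) S.bound H) none := by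
    refine A.language_eq step val (List.pairwise_cons.2 ⟨fun r hr => ?_, hl⟩) (fun r => ?_) H
    · exact lt_top_iff_ne_top.2 fun h => htop (h ▸ hr)
    · induction r using WithTop.recTopCoe with
      | top => simp
      | coe r => exact List.mem_cons_of_mem _ (hc r)
  -- The entry states have the outermost rank, and inside they work as the given automata.
  have hentry : ∀ X j, S.level l ⊤ H X (entry j) = T (X ∘ entry) j := by
    intro X j
    let proj : Rank B → Option (B j).R := fun r =>
      if h : ∃ r', innerRank j r' = r then some h.choose else none
    have hproj : ∀ r r', proj r = some r' ↔ innerRank j r' = r := by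
      intro r r'
      by_cases h : ∃ r', innerRank j r' = r
      · simp only [proj, dif_pos h, Option.some_inj]
        have h1 := h.choose_spec
        exact ⟨fun h2 => h2 ▸ h1, fun h2 =>
          (innerRank_strictMono j).injective (h1.trans h2.symm)⟩
      · simp only [proj, dif_neg h]
        exact ⟨fun h2 => by simp at h2, fun h2 => absurd ⟨r', h2⟩ h⟩
    let S' := (B j).aut.system step (subst sub val (X ∘ entry))
    have hH : ∀ i, overwrite S.rank ⊤ H X (entry i) = (X ∘ entry) i := fun i =>
      overwrite_of_eq rfl
    have hloc := S.nested_comp S' (inner j) entry proj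
      (fun r q => (hproj r _).symm) (fun r r' h => ?_) (l := l) (fun _ => htop) (X ∘ entry)
      (fun Y hY => ?_) (overwrite S.rank ⊤ H X) hH
    · have hfix : S.nested l S.bound (overwrite S.rank ⊤ H X) ∘ entry = X ∘ entry := by
        funext i
        exact (S.nested_apply_of_notMem _ _ htop).trans (hH i)
      change A.stepOp step val (S.nested l S.bound (overwrite S.rank ⊤ H X)) (entry j) = _
      rw [stepOp_entry, hfix, hloc, ← hB]
      refine (Automaton.language_eq _ _ _ ?_ (fun r => ?_) _).symm
      · refine hl.filterMap _ fun r s hrs r' hr s' hs => ?_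
        rw [hproj] at hr hs
        rw [← hr, ← hs] at hrs
        exact (innerRank_strictMono j).lt_iff_lt.1 hrs
      · exact List.mem_filterMap.2 ⟨innerRank j r, hc _, (hproj _ _).2 rfl⟩
    · obtain rfl := (hproj r r').1 h
      refine ⟨rfl, ?_⟩
      change A.bound _ = _
      rw [combine_bound]
      rfl
    · funext q
      change A.stepOp step val Y (inner j q) = _
      rw [stepOp_inner, show Y ∘ entry = X ∘ entry from funext hY]
      rfl
  have hval : S.nested (⊤ :: l) S.bound H ∘ entry = approx η T α := by
    funext j
    rw [System.nested_cons]
    refine (S.nested_apply_of_notMem _ _ htop).trans ((overwrite_of_eq rfl).trans ?_)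
    have hb : S.bound ⊤ = α := congrFun combine_bound ⊤
    have hk : S.kind ⊤ = η := η.kind_player
    rw [hb, hk]
    exact congrFun (approx_comp entry η (S.level_mono l ⊤ H) hT
      (fun X => funext (hentry X)) α) j
  rw [hlang, Automaton.stepOp_eq_stepSet]
  refine (stepSet_mapTarget _ _ _ _ _).trans ?_
  congr 1
  funext z
  rcases z with j | x
  · exact congrFun hval j
  · rfl

/-- One move to the languages of automata. -/
theorem language_combine_step {T : Fin n → Set M} (hB : ∀ j, (B j).aut.language step val = T j) :
    (combine B .mu ⊤ (fun _ => none) P D).language step val =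
      stepSet step (Sum.elim T val) P D := by
  rw [language_combine (T := fun _ => T) monotone_const fun _ j => hB j]
  have h := map_approx_top.{o} .mu (F := fun _ : Fin n → Set M => T) monotone_const
  rw [← h]

end

end Combine

open Combine in
theorem Formula.exists_automaton {Act Var : Type*} (φ : Formula.{o} Act Var) :
    ∃ B : FiniteAutomaton.{o} Act Var, ∀ (M : Type w) (step : Act → M → M → Prop)
      (val : Var → Set M), B.aut.language step val = φ.sem step val := by
  classical
  induction φ with
  | var x =>
    refine ⟨⟨_, _, combine Fin.elim0 .mu ⊤ (fun _ => none) .eve (.inl {.inr x})⟩,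
      fun M step val => ?_⟩
    rw [language_combine_step (T := Fin.elim0) (fun j => j.elim0)]
    simp [stepSet, sem]
  | top =>
    refine ⟨⟨_, _, combine Fin.elim0 .mu ⊤ (fun _ => none) .adam (.inl ∅)⟩,
      fun M step val => ?_⟩
    rw [language_combine_step (T := Fin.elim0) (fun j => j.elim0)]
    simp [stepSet, sem]
  | bot =>
    refine ⟨⟨_, _, combine Fin.elim0 .mu ⊤ (fun _ => none) .eve (.inl ∅)⟩,
      fun M step val => ?_⟩
    rw [language_combine_step (T := Fin.elim0) (fun j => j.elim0)]
    simp [stepSet, sem]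
  | or φ ψ h1 h2 =>
    obtain ⟨B1, h1⟩ := h1
    obtain ⟨B2, h2⟩ := h2
    refine ⟨⟨_, _, combine ![B1, B2] .mu ⊤ (fun _ => none) .eve (.inl {.inl 0, .inl 1})⟩,
      fun M step val => ?_⟩
    rw [language_combine_step (T := ![φ.sem step val, ψ.sem step val])
      (Fin.forall_fin_two.2 ⟨h1 M step val, h2 M step val⟩)]
    ext m
    simp [stepSet, sem, -Sum.exists]
  | and φ ψ h1 h2 =>
    obtain ⟨B1, h1⟩ := h1
    obtain ⟨B2, h2⟩ := h2
    refine ⟨⟨_, _, combine ![B1, B2] .mu ⊤ (fun _ => none) .adam (.inl {.inl 0, .inl 1})⟩,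
      fun M step val => ?_⟩
    rw [language_combine_step (T := ![φ.sem step val, ψ.sem step val])
      (Fin.forall_fin_two.2 ⟨h1 M step val, h2 M step val⟩)]
    ext m
    simp [stepSet, sem, -Sum.forall]
  | dia τ φ ih =>
    obtain ⟨B, h⟩ := ih
    refine ⟨⟨_, _, combine (fun _ : Fin 1 => B) .mu ⊤ (fun _ => none) .eve (.inr (τ, .inl 0))⟩,
      fun M step val => ?_⟩
    rw [language_combine_step (T := fun _ => φ.sem step val) fun _ => h M step val]
    rfl
  | box τ φ ih =>
    obtain ⟨B, h⟩ := ih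
    refine ⟨⟨_, _, combine (fun _ : Fin 1 => B) .mu ⊤ (fun _ => none) .adam (.inr (τ, .inl 0))⟩,
      fun M step val => ?_⟩
    rw [language_combine_step (T := fun _ => φ.sem step val) fun _ => h M step val]
    rfl
  | @fix η α n x φ i ih =>
    choose B hB using ih
    let sub : Var → Option (Fin n) := fun y => if h : ∃ j, x j = y then some h.choose else none
    have hsub : ∀ (M : Type w) (val : Var → Set M) Y,
        subst sub val Y = Function.extend x Y val := by
      intro M val Y
      funext y
      by_cases h : ∃ j, x j = y
      · have h1 := x.injective.extend_apply Y val h.choose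
        rw [h.choose_spec] at h1
        rw [h1, subst]
        simp only [sub, dif_pos h]
      · rw [Function.extend_apply' _ _ _ h, subst]
        simp only [sub, dif_neg h]
    refine ⟨⟨_, _, combine B η α sub .eve (.inl {.inl i})⟩, fun M step val => ?_⟩
    rw [language_combine
      (T := fun Y j => (φ j).sem step (Function.extend x Y val))
      (fun H H' hH j => Formula.sem_mono step _ (extend_mono x hH le_rfl))
      fun Y j => by rw [hsub, hB]]
    simp [stepSet, sem]

end Countdown

theorem mainTheorem2 {Act : Type*} {Var : Type*} [Infinite Var] :
    (∀ (Q : Type*) (R : Type*) [Finite Q] [LinearOrder R] [Finite R]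
        (A : Countdown.Automaton.{o} Act Var Q R),
      ∃ φ : Countdown.Formula.{o} Act Var,
        ∀ (M : Type w) (step : Act → M → M → Prop) (val : Var → Set M),
          A.language step val = φ.sem step val) ∧
    (∀ φ : Countdown.Formula.{o} Act Var,
      ∃ (Q : Type) (R : Type) (_ : Finite Q) (_ : LinearOrder R) (_ : Finite R)
        (A : Countdown.Automaton.{o} Act Var Q R),
        ∀ (M : Type w) (step : Act → M → M → Prop) (val : Var → Set M),
          φ.sem step val = A.language step val) := by
  refine ⟨fun Q R _ _ _ A => A.exists_formula, fun φ => ?_⟩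
  obtain ⟨B, hB⟩ := φ.exists_automaton
  exact ⟨B.Q, B.R, inferInstance, inferInstance, inferInstance, B.aut,
    fun M step val => (hB M step val).symm⟩
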